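/- For $\alpha,\beta,F\in\mathbb{C}$ let $\mathcal{L}$ be the extended Heisenberg–Virasoro algebra: the complex Lie algebra with basis $L_m, J_m, G_m$ ($m\in\mathbb{Z}$), $C_1,C_2,C_3$, where $C_1,C_2,C_3$ are central and, for all $m,n\in\mathbb{Z}$, \begin{align*} &[L_m,L_n]=(m-n)L_{m+n}+\tfrac{m^3-m}{12}\,\delta_{m+n,0}C_1, && [G_m,G_n]=0,\\ &[L_m,J_n]=-nJ_{m+n}-(m^2+m)\,\delta_{m+n,0}C_2, && [J_m,J_n]=m\,\delta_{m+n,0}C_3,\\ &[L_m,G_n]=-(\alpha+n+m\beta)G_{m+n}, && [J_m,G_n]=F\,G_{m+n}. \end{align*} For an integer $d\ge 0$ let $\mathcal{L}_d$ be the subalgebra spanned by $L_i$, $J_i$, $G_{-d+i}$ ($i\ge 0$) and $C_1,C_2,C_3$. Suppose that $F\neq 0$, let $d\ge 0$ be an integer, and let $V$ be a simple $\mathcal{L}_d$-module. Assume that there are integers $k,l\ge 0$ with $l>k+d>0$ such that (a) $G_k$ and $L_l$ act injectively on $V$, and (b) $G_{k+i}V=J_{k+d+i}V=L_{l+i}V=0$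 for all integers $i\ge 1$. Then the induced module $\mathrm{Ind}_{\mathcal{L}_d}^{\mathcal{L}}(V)=U(\mathcal{L})\otimes_{U(\mathcal{L}_d)}V$ is a simple $\mathcal{L}$-module. -/

import Mathlib

open scoped TensorProduct

noncomputable section

/-! ### Induced modules -/

namespace LieInduction

attribute [local instance 100] LieRing.ofAssociativeRing

variable (R : Type*) [CommRing R] {𝔤 : Type*} [LieRing 𝔤] [LieAlgebra R 𝔤]
  (𝔥 : LieSubalgebra R 𝔤)
  (V : Type*) [AddCommGroup V] [Module R V] [LieRingModule 𝔥 V] [LieModule R 𝔥 V]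

/-- The homomorphism `U(𝔥) → U(𝔤)` given by the inclusion of the subalgebra `𝔥` in `𝔤`. -/
def envIncl : UniversalEnvelopingAlgebra R 𝔥 →ₐ[R] UniversalEnvelopingAlgebra R 𝔤 :=
  UniversalEnvelopingAlgebra.lift R ((UniversalEnvelopingAlgebra.ι R).comp 𝔥.incl)

/-- The action of `U(𝔥)` on the `𝔥`-module `V`. -/
def envAction : UniversalEnvelopingAlgebra R 𝔥 →ₐ[R] Module.End R V :=
  UniversalEnvelopingAlgebra.lift R (LieModule.toEnd R 𝔥 V)

/-- The `U(𝔤)`-submodule of `U(𝔤) ⊗[R] V` generated by the elements `u w ⊗ v - u ⊗ w v`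
with `u ∈ U(𝔤)`, `w ∈ U(𝔥)`, `v ∈ V`. -/
def relations : Submodule (UniversalEnvelopingAlgebra R 𝔤)
    (UniversalEnvelopingAlgebra R 𝔤 ⊗[R] V) :=
  Submodule.span _ {t | ∃ (u : UniversalEnvelopingAlgebra R 𝔤)
    (w : UniversalEnvelopingAlgebra R 𝔥) (v : V),
    t = (u * envIncl R 𝔥 w) ⊗ₜ[R] v - u ⊗ₜ[R] (envAction R 𝔥 V w v)}

/-- The induced module `U(𝔤) ⊗_{U(𝔥)} V` (Mathlib's tensor product is over commutative rings
only, so the tensor product over `U(𝔥)` is written as a quotient of the one over `R`). -/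
def Ind : Type _ := (UniversalEnvelopingAlgebra R 𝔤 ⊗[R] V) ⧸ relations R 𝔥 V

instance : AddCommGroup (Ind R 𝔥 V) :=
  inferInstanceAs (AddCommGroup ((UniversalEnvelopingAlgebra R 𝔤 ⊗[R] V) ⧸ relations R 𝔥 V))

instance : Module (UniversalEnvelopingAlgebra R 𝔤) (Ind R 𝔥 V) :=
  inferInstanceAs (Module (UniversalEnvelopingAlgebra R 𝔤)
    ((UniversalEnvelopingAlgebra R 𝔤 ⊗[R] V) ⧸ relations R 𝔥 V))

instance : Module R (Ind R 𝔥 V) :=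
  inferInstanceAs (Module R ((UniversalEnvelopingAlgebra R 𝔤 ⊗[R] V) ⧸ relations R 𝔥 V))

instance : IsScalarTower R (UniversalEnvelopingAlgebra R 𝔤) (Ind R 𝔥 V) :=
  inferInstanceAs (IsScalarTower R (UniversalEnvelopingAlgebra R 𝔤)
    ((UniversalEnvelopingAlgebra R 𝔤 ⊗[R] V) ⧸ relations R 𝔥 V))

/-- `𝔤` acts on the induced module through `𝔤 → U(𝔤)`, by left multiplication. -/
instance : LieRingModule 𝔤 (Ind R 𝔥 V) where
  bracket x m := UniversalEnvelopingAlgebra.ι R x • m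
  add_lie x y m := by
    change UniversalEnvelopingAlgebra.ι R (x + y) • m = _
    rw [map_add, add_smul]
  lie_add x m n := smul_add (UniversalEnvelopingAlgebra.ι R x) m n
  leibniz_lie x y m := by
    change UniversalEnvelopingAlgebra.ι R x • UniversalEnvelopingAlgebra.ι R y • m =
      UniversalEnvelopingAlgebra.ι R ⁅x, y⁆ • m +
        UniversalEnvelopingAlgebra.ι R y • UniversalEnvelopingAlgebra.ι R x • m
    rw [LieHom.map_lie, LieRing.of_associative_ring_bracket, sub_smul, mul_smul, mul_smul,
      sub_add_cancel]

instance : LieModule R 𝔤 (Ind R 𝔥 V) where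
  smul_lie t x m := by
    change UniversalEnvelopingAlgebra.ι R (t • x) • m = t • (UniversalEnvelopingAlgebra.ι R x • m)
    rw [map_smul, smul_assoc]
  lie_smul t x m := by
    change UniversalEnvelopingAlgebra.ι R x • (t • m) = t • (UniversalEnvelopingAlgebra.ι R x • m)
    rw [← algebraMap_smul (UniversalEnvelopingAlgebra R 𝔤) t m,
      ← algebraMap_smul (UniversalEnvelopingAlgebra R 𝔤) t (_ • m), smul_smul, smul_smul,
      Algebra.commutes]

end LieInduction

/-! ### The extended Heisenberg-Virasoro algebra -/

namespace ExtHV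

/-- Labels of the basis `L_m, J_m, G_m` (`m ∈ ℤ`), `C_1, C_2, C_3`. -/
inductive Gen : Type
  | L (m : ℤ)
  | J (m : ℤ)
  | G (m : ℤ)
  | C₁
  | C₂
  | C₃

end ExtHV

/-- The extended Heisenberg-Virasoro algebra with parameters `α, β, F`: the complex vector space
with basis `L_m, J_m, G_m` (`m ∈ ℤ`), `C_1, C_2, C_3`. -/
@[nolint unusedArguments]
def ExtHV (_α _β _F : ℂ) : Type := ExtHV.Gen →₀ ℂ

namespace ExtHV

variable (α β F : ℂ)

instance : AddCommGroup (ExtHV α β F) := inferInstanceAs (AddCommGroup (Gen →₀ ℂ))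

instance : Module ℂ (ExtHV α β F) := inferInstanceAs (Module ℂ (Gen →₀ ℂ))

/-- The basis of the algebra. -/
def basis : Module.Basis Gen ℂ (ExtHV α β F) := Finsupp.basisSingleOne

/-- The basis vector `L_m`. -/
def L (m : ℤ) : ExtHV α β F := basis α β F (.L m)
/-- The basis vector `J_m`. -/
def J (m : ℤ) : ExtHV α β F := basis α β F (.J m)
/-- The basis vector `G_m`. -/
def G (m : ℤ) : ExtHV α β F := basis α β F (.G m)
/-- The central basis vector `C_1`. -/
def C₁ : ExtHV α β F := basis α β F .C₁
/-- The central basis vector `C_2`. -/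
def C₂ : ExtHV α β F := basis α β F .C₂
/-- The central basis vector `C_3`. -/
def C₃ : ExtHV α β F := basis α β F .C₃

/-- The brackets of the basis vectors. -/
def genBracket : Gen → Gen → ExtHV α β F
  | .L m, .L n => ((m : ℂ) - n) • L α β F (m + n) +
      (if m + n = 0 then ((m : ℂ) ^ 3 - m) / 12 else 0) • C₁ α β F
  | .L m, .J n => (-(n : ℂ)) • J α β F (m + n) -
      (if m + n = 0 then (m : ℂ) ^ 2 + m else 0) • C₂ α β F
  | .J n, .L m => (n : ℂ) • J α β F (m + n) +
      (if m + n = 0 then (m : ℂ) ^ 2 + m else 0) • C₂ α β F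
  | .J m, .J n => (if m + n = 0 then (m : ℂ) else 0) • C₃ α β F
  | .L m, .G n => (-(α + n + m * β)) • G α β F (m + n)
  | .G n, .L m => (α + n + m * β) • G α β F (m + n)
  | .J m, .G n => F • G α β F (m + n)
  | .G n, .J m => (-F) • G α β F (m + n)
  | _, _ => 0

/-- The bilinear extension of `genBracket`. -/
def bracketₗ : ExtHV α β F →ₗ[ℂ] ExtHV α β F →ₗ[ℂ] ExtHV α β F :=
  (basis α β F).constr ℂ fun a => (basis α β F).constr ℂ fun b => genBracket α β F a b

theorem bracketₗ_basis (a b : Gen) :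
    bracketₗ α β F (basis α β F a) (basis α β F b) = genBracket α β F a b := by
  simp [bracketₗ, Module.Basis.constr_basis]

theorem bracketₗ_swap (x y : ExtHV α β F) : bracketₗ α β F x y = -bracketₗ α β F y x := by
  have h : bracketₗ α β F = -(bracketₗ α β F).flip := by
    refine (basis α β F).ext fun a => (basis α β F).ext fun b => ?_
    simp only [LinearMap.neg_apply, LinearMap.flip_apply, bracketₗ_basis]
    cases a <;> cases b <;> simp only [genBracket, neg_zero]
    case L.L m n =>
      rw [add_comm n m]
      split_ifs with h
      · obtain rfl : n = -m := by omega
        push_cast; module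
      · module
    case J.J m n =>
      rw [add_comm n m]
      split_ifs with h
      · obtain rfl : n = -m := by omega
        push_cast; module
      · module
    all_goals module
  exact congrArg (fun f => f x y) h

theorem jacobi_basis (a b c : Gen) :
    bracketₗ α β F (basis α β F a) (bracketₗ α β F (basis α β F b) (basis α β F c)) =
      bracketₗ α β F (bracketₗ α β F (basis α β F a) (basis α β F b)) (basis α β F c) +
        bracketₗ α β F (basis α β F b) (bracketₗ α β F (basis α β F a) (basis α β F c)) := by
  have hl (z : Gen) (hz : ∀ b, genBracket α β F z b = 0) :
      bracketₗ α β F (basis α β F z) = 0 :=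
    (basis α β F).ext fun b => by rw [bracketₗ_basis, hz, LinearMap.zero_apply]
  have hl₁ := hl .C₁ fun b => by cases b <;> rfl
  have hl₂ := hl .C₂ fun b => by cases b <;> rfl
  have hl₃ := hl .C₃ fun b => by cases b <;> rfl
  have hr (z : Gen) (hz : bracketₗ α β F (basis α β F z) = 0) (x : ExtHV α β F) :
      bracketₗ α β F x (basis α β F z) = 0 := by
    rw [bracketₗ_swap, hz, LinearMap.zero_apply, neg_zero]
  have hr₁ := hr _ hl₁
  have hr₂ := hr _ hl₂
  have hr₃ := hr _ hl₃
  have h0 (x : ExtHV α β F) : (0 : ExtHV α β F →ₗ[ℂ] ExtHV α β F) x = 0 := rfl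
  cases a
  all_goals try simp only [hl₁, hl₂, hl₃, h0, map_zero, add_zero]
  all_goals cases b
  all_goals try simp only [hl₁, hl₂, hl₃, hr₁, hr₂, hr₃, h0, map_zero, add_zero]
  all_goals cases c
  all_goals try simp only [hr₁, hr₂, hr₃, map_zero, add_zero]
  all_goals rename_i m n p
  all_goals simp only [bracketₗ_basis, genBracket, L, J, G, C₁, C₂, C₃, map_add, map_sub,
    map_smul, map_zero, LinearMap.smul_apply, hl₁, hl₂, hl₃, hr₁, hr₂, hr₃, h0, smul_zero, add_zero, sub_zero]
  all_goals
    try simp only [Int.cast_add]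
    simp only [add_assoc, add_left_comm, add_comm]
    by_cases h : m + (n + p) = 0
    · obtain rfl : p = -m - n := by omega
      try simp only [h, if_true, Int.cast_sub, Int.cast_neg]
      match_scalars <;> ring
    · try simp only [h, if_false]
      match_scalars <;> ring

theorem bracketₗ_jacobi (x y z : ExtHV α β F) :
    bracketₗ α β F x (bracketₗ α β F y z) =
      bracketₗ α β F (bracketₗ α β F x y) z + bracketₗ α β F y (bracketₗ α β F x z) := by
  have hspan (w : ExtHV α β F) : w ∈ Submodule.span ℂ (Set.range (basis α β F)) :=
    (basis α β F).mem_span w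
  induction hspan x using Submodule.span_induction with
  | zero => simp
  | add u v _ _ hu hv => simp only [map_add, LinearMap.add_apply, hu, hv]; abel
  | smul t u _ hu => simp only [map_smul, LinearMap.smul_apply, hu, smul_add]
  | mem u hu =>
    obtain ⟨a, rfl⟩ := hu
    induction hspan y using Submodule.span_induction with
    | zero => simp
    | add u v _ _ hu hv => simp only [map_add, LinearMap.add_apply, hu, hv]; abel
    | smul t u _ hu => simp only [map_smul, LinearMap.smul_apply, hu, smul_add]
    | mem u hu =>
      obtain ⟨b, rfl⟩ := hu
      induction hspan z using Submodule.span_induction with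
      | zero => simp
      | add u v _ _ hu hv => simp only [map_add, hu, hv]; abel
      | smul t u _ hu => simp only [map_smul, hu, smul_add]
      | mem u hu =>
        obtain ⟨c, rfl⟩ := hu
        exact jacobi_basis α β F a b c

instance : LieRing (ExtHV α β F) where
  bracket x y := bracketₗ α β F x y
  add_lie x y z := by
    change bracketₗ α β F (x + y) z = _
    rw [map_add]; rfl
  lie_add x y z := map_add (bracketₗ α β F x) y z
  lie_self x := by
    have h := bracketₗ_swap α β F x x
    have h2 : (2 : ℂ) • bracketₗ α β F x x = 0 := by
      rw [two_smul]; nth_rewrite 1 [h]; exact neg_add_cancel _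
    exact (smul_eq_zero.mp h2).resolve_left two_ne_zero
  leibniz_lie x y z := bracketₗ_jacobi α β F x y z

instance : LieAlgebra ℂ (ExtHV α β F) where
  toModule := inferInstanceAs (Module ℂ (ExtHV α β F))
  lie_smul t x y := map_smul (bracketₗ α β F x) t y

/-- The spanning set `L_i, J_i, G_{-d+i}` (`i ≥ 0`), `C_1, C_2, C_3` of the subalgebra `𝓛_d`. -/
def posGens (d : ℕ) : Set (ExtHV α β F) :=
  {x | (∃ i : ℕ, x = L α β F i) ∨ (∃ i : ℕ, x = J α β F i) ∨
    (∃ i : ℕ, x = G α β F (-(d : ℤ) + i)) ∨ x = C₁ α β F ∨ x = C₂ α β F ∨ x = C₃ α β F}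

theorem bracketₗ_mem (d : ℕ) {x y : ExtHV α β F} (hx : x ∈ posGens α β F d)
    (hy : y ∈ posGens α β F d) :
    bracketₗ α β F x y ∈ Submodule.span ℂ (posGens α β F d) := by
  have hL (n : ℤ) (h : 0 ≤ n) : L α β F n ∈ Submodule.span ℂ (posGens α β F d) :=
    Submodule.subset_span (Or.inl ⟨n.toNat, by rw [Int.toNat_of_nonneg h]⟩)
  have hJ (n : ℤ) (h : 0 ≤ n) : J α β F n ∈ Submodule.span ℂ (posGens α β F d) :=
    Submodule.subset_span (Or.inr (Or.inl ⟨n.toNat, by rw [Int.toNat_of_nonneg h]⟩))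
  have hG (n : ℤ) (h : 0 ≤ d + n) : G α β F n ∈ Submodule.span ℂ (posGens α β F d) :=
    Submodule.subset_span (Or.inr (Or.inr (Or.inl ⟨(d + n).toNat, by
      rw [Int.toNat_of_nonneg h, neg_add_cancel_left]⟩)))
  have hC₁ : C₁ α β F ∈ Submodule.span ℂ (posGens α β F d) :=
    Submodule.subset_span (by simp [posGens])
  have hC₂ : C₂ α β F ∈ Submodule.span ℂ (posGens α β F d) :=
    Submodule.subset_span (by simp [posGens])
  have hC₃ : C₃ α β F ∈ Submodule.span ℂ (posGens α β F d) :=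
    Submodule.subset_span (by simp [posGens])
  rcases hx with ⟨i, rfl⟩ | ⟨i, rfl⟩ | ⟨i, rfl⟩ | rfl | rfl | rfl <;>
  rcases hy with ⟨j, rfl⟩ | ⟨j, rfl⟩ | ⟨j, rfl⟩ | rfl | rfl | rfl <;>
  first
  | rw [L, L, bracketₗ_basis, genBracket]
    exact add_mem (Submodule.smul_mem _ _ (hL _ (by omega))) (Submodule.smul_mem _ _ hC₁)
  | rw [L, J, bracketₗ_basis, genBracket]
    exact sub_mem (Submodule.smul_mem _ _ (hJ _ (by omega))) (Submodule.smul_mem _ _ hC₂)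
  | rw [L, J, bracketₗ_basis, genBracket]
    exact add_mem (Submodule.smul_mem _ _ (hJ _ (by omega))) (Submodule.smul_mem _ _ hC₂)
  | rw [J, J, bracketₗ_basis, genBracket]
    exact Submodule.smul_mem _ _ hC₃
  | rw [L, G, bracketₗ_basis, genBracket]
    exact Submodule.smul_mem _ _ (hG _ (by omega))
  | rw [J, G, bracketₗ_basis, genBracket]
    exact Submodule.smul_mem _ _ (hG _ (by omega))
  | simp only [L, J, G, C₁, C₂, C₃, bracketₗ_basis, genBracket, zero_mem]

/-- The subalgebra `𝓛_d`, the linear span of `L_i, J_i, G_{-d+i}` (`i ≥ 0`) and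
`C_1, C_2, C_3`. -/
def sub (d : ℕ) : LieSubalgebra ℂ (ExtHV α β F) where
  __ := Submodule.span ℂ (posGens α β F d)
  lie_mem' {x y} hx hy := by
    change bracketₗ α β F x y ∈ Submodule.span ℂ (posGens α β F d)
    induction hx using Submodule.span_induction with
    | zero => simp
    | add u v _ _ hu hv => rw [map_add, LinearMap.add_apply]; exact add_mem hu hv
    | smul t u _ hu => rw [map_smul, LinearMap.smul_apply]; exact Submodule.smul_mem _ t hu
    | mem x hx =>
      induction hy using Submodule.span_induction with
      | zero => simp
      | add u v _ _ hu hv => rw [map_add]; exact add_mem hu hv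
      | smul t u _ hu => rw [map_smul]; exact Submodule.smul_mem _ t hu
      | mem y hy => exact bracketₗ_mem α β F d hx hy

theorem L_mem (d i : ℕ) : L α β F i ∈ sub α β F d :=
  Submodule.subset_span (Or.inl ⟨i, rfl⟩)

theorem J_mem (d i : ℕ) : J α β F i ∈ sub α β F d :=
  Submodule.subset_span (Or.inr (Or.inl ⟨i, rfl⟩))

theorem G_mem (d i : ℕ) : G α β F i ∈ sub α β F d :=
  Submodule.subset_span (Or.inr (Or.inr (Or.inl ⟨d + i, by congr 1; push_cast; ring⟩)))

/-- `L_i` (`i ≥ 0`) as an element of `𝓛_d`. -/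
def subL (d i : ℕ) : sub α β F d := ⟨L α β F i, L_mem α β F d i⟩
/-- `J_i` (`i ≥ 0`) as an element of `𝓛_d`. -/
def subJ (d i : ℕ) : sub α β F d := ⟨J α β F i, J_mem α β F d i⟩
/-- `G_i` (`i ≥ 0`) as an element of `𝓛_d`. -/
def subG (d i : ℕ) : sub α β F d := ⟨G α β F i, G_mem α β F d i⟩

end ExtHV

end

/-!
The induced module is filtered by the weight of words in `L_{-i}, J_{-i}, G_{-d-i}` (`i ≥ 1`, each
of weight `i`), with coefficients in `V`, and sorted words suffice. No uniqueness of sorted normal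
forms (Poincaré-Birkhoff-Witt) is needed: among the letters of the leading term of a nonzero vector
take the smallest `x`, of weight `p`. One of the elements `L_{l+p}, G_{k+p}, J_{k+d+p}`, according
to whether `x` is `L_{-p}, J_{-p}` or `G_{-d-p}`, lowers the weight by `p` and acts on the leading
term as the formal derivative in `x` followed by a nonzero multiple of `L_l` or `G_k` on the
coefficients, hence injectively, because the bracket with `x` is that multiple and `(a)` applies.
By descent every nonzero submodule contains a nonzero vector of the image of `V`, hence all of `V`,
which generates. That `V` embeds in the induced module follows from the existence of a subalgebra
`𝔫` complementary to `𝓛_d`: then the whole algebra acts on `U(𝔫) ⊗ V`, extending `V`.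
-/

namespace LieInduction

attribute [local instance 100] LieRing.ofAssociativeRing

section Enveloping

open UniversalEnvelopingAlgebra

variable {R : Type*} [CommRing R] {𝔤 : Type*} [LieRing 𝔤] [LieAlgebra R 𝔤]

local notation "𝓤" => UniversalEnvelopingAlgebra R

theorem env_induction {P : 𝓤 𝔤 → Prop} (one : P 1) (add : ∀ u w, P u → P w → P (u + w))
    (smul : ∀ (t : R) u, P u → P (t • u)) (mul : ∀ x u, P u → P (ι R x * u)) (u : 𝓤 𝔤) : P u := by
  have mul_right (a : TensorAlgebra R 𝔤) : ∀ w, P w → P (mkAlgHom R 𝔤 a * w) := by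
    induction a using TensorAlgebra.induction with
    | algebraMap r =>
      intro w hw
      rw [AlgHom.commutes, ← Algebra.smul_def]
      exact smul r w hw
    | ι x => exact fun w hw => mul x w hw
    | mul a b ha hb =>
      intro w hw
      rw [map_mul, mul_assoc]
      exact ha _ (hb _ hw)
    | add a b ha hb =>
      intro w hw
      rw [map_add, add_mul]
      exact add _ _ (ha _ hw) (hb _ hw)
  obtain ⟨a, rfl⟩ : ∃ a, mkAlgHom R 𝔤 a = u :=
    RingCon.mkₐ_surjective (UniversalEnvelopingAlgebra.ringCon R 𝔤) u
  simpa only [mul_one] using mul_right a 1 one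

section FreeModule

variable {V : Type*} [AddCommGroup V] [Module R V]

theorem env_tmul_induction {P : 𝓤 𝔤 ⊗[R] V → Prop} (one : ∀ v, P (1 ⊗ₜ v))
    (add : ∀ a b, P a → P b → P (a + b)) (smul : ∀ (t : R) a, P a → P (t • a))
    (mul : ∀ (x : 𝔤) a, P a → P (ι R x • a)) (a : 𝓤 𝔤 ⊗[R] V) : P a := by
  induction a using TensorProduct.induction_on with
  | zero => simpa only [zero_smul] using smul 0 _ (one 0)
  | add a b ha hb => exact add a b ha hb
  | tmul u v =>
    induction u using env_induction with
    | one => exact one v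
    | add u w hu hw => rw [TensorProduct.add_tmul]; exact add _ _ hu hw
    | smul t u hu => rw [← TensorProduct.smul_tmul']; exact smul _ _ hu
    | mul x u hu => exact mul x _ hu

variable {M : Type*} [AddCommGroup M] [Module R M] (ρ : 𝔤 →ₗ⁅R⁆ Module.End R M) (f : V →ₗ[R] M)

/-- The `𝔤`-equivariant extension `u ⊗ v ↦ ρ(u) (f v)` of a linear map `f` from `V` to a
representation `ρ` of `𝔤` to the free module `U(𝔤) ⊗ V`. -/
noncomputable def envExtend : 𝓤 𝔤 ⊗[R] V →ₗ[R] M :=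
  TensorProduct.lift (LinearMap.lcomp R M f ∘ₗ (lift R ρ).toLinearMap)

theorem envExtend_tmul (u : 𝓤 𝔤) (v : V) : envExtend ρ f (u ⊗ₜ v) = lift R ρ u (f v) := rfl

theorem envExtend_one_tmul (v : V) : envExtend ρ f (1 ⊗ₜ v) = f v := by
  rw [envExtend_tmul, map_one, Module.End.one_apply]

theorem envExtend_smul (u : 𝓤 𝔤) (a : 𝓤 𝔤 ⊗[R] V) :
    envExtend ρ f (u • a) = lift R ρ u (envExtend ρ f a) := by
  induction a using TensorProduct.induction_on with
  | zero => simp only [smul_zero, map_zero]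
  | add a b ha hb => rw [smul_add, map_add, map_add, map_add, ha, hb]
  | tmul w v =>
    rw [TensorProduct.smul_tmul', smul_eq_mul, envExtend_tmul, envExtend_tmul, map_mul,
      Module.End.mul_apply]

theorem envExtend_ι_smul (x : 𝔤) (a : 𝓤 𝔤 ⊗[R] V) :
    envExtend ρ f (ι R x • a) = ρ x (envExtend ρ f a) := by
  rw [envExtend_smul, lift_ι_apply]

theorem env_one_tmul_injective : Function.Injective fun v : V => (1 : 𝓤 𝔤) ⊗ₜ[R] v := by
  let augmentation : 𝓤 𝔤 ⊗[R] V →ₗ[R] V := envExtend (0 : 𝔤 →ₗ⁅R⁆ Module.End R V) LinearMap.id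
  exact Function.LeftInverse.injective (g := augmentation) fun v => envExtend_one_tmul _ _ v

end FreeModule

section Incl

variable (𝔥 : LieSubalgebra R 𝔤) {V : Type*} [AddCommGroup V] [Module R V]
  [LieRingModule 𝔥 V] [LieModule R 𝔥 V]

variable (R V) in
/-- The canonical map `v ↦ 1 ⊗ v` from `V` to the induced module. -/
noncomputable def incl : V →ₗ[R] Ind R 𝔥 V :=
  ((relations R 𝔥 V).mkQ.restrictScalars R) ∘ₗ TensorProduct.mk R (𝓤 𝔤) V 1

variable {𝔥}

theorem lie_incl (h : 𝔥) (v : V) : ⁅(h : 𝔤), incl R 𝔥 V v⁆ = incl R 𝔥 V ⁅h, v⁆ := by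
  refine (Submodule.Quotient.eq (relations R 𝔥 V)).mpr (Submodule.subset_span ⟨1, ι R h, v, ?_⟩)
  change (ι R (h : 𝔤) * 1) ⊗ₜ v - 1 ⊗ₜ ⁅h, v⁆ = _
  rw [mul_one, one_mul, envIncl, envAction, lift_ι_apply, lift_ι_apply]
  rfl

theorem lieSpan_range_incl : LieSubmodule.lieSpan R 𝔤 (Set.range (incl R 𝔥 V)) = ⊤ := by
  suffices h : ∀ a, a ∈ LieSubmodule.lieSpan R 𝔤 (Set.range (incl R 𝔥 V)) from
    eq_top_iff.mpr fun a _ => h a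
  intro a
  obtain ⟨a, rfl⟩ := Submodule.Quotient.mk_surjective _ a
  induction a using env_tmul_induction with
  | one v => exact LieSubmodule.subset_lieSpan ⟨v, rfl⟩
  | add a b ha hb => exact add_mem ha hb
  | smul t a ha => exact Submodule.smul_mem _ t ha
  | mul x a ha => exact LieSubmodule.lie_mem _ ha

section Equivariant

variable {M : Type*} [AddCommGroup M] [Module R M] {ρ : 𝔤 →ₗ⁅R⁆ Module.End R M} {f : V →ₗ[R] M}

theorem lift_envIncl_of_equivariant (hf : ∀ (h : 𝔥) v, ρ h (f v) = f ⁅h, v⁆) (w : 𝓤 𝔥) (v : V) :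
    lift R ρ (envIncl R 𝔥 w) (f v) = f (envAction R 𝔥 V w v) := by
  induction w using env_induction with
  | one => simp only [map_one, Module.End.one_apply]
  | add u w hu hw => simp only [map_add, LinearMap.add_apply, hu, hw]
  | smul t u hu => simp only [map_smul, LinearMap.smul_apply, hu]
  | mul h u hu =>
    rw [map_mul, map_mul, map_mul, Module.End.mul_apply, Module.End.mul_apply, hu, envIncl,
      lift_ι_apply, LieHom.comp_apply, lift_ι_apply, LieSubalgebra.coe_incl, hf, envAction,
      lift_ι_apply, LieModule.toEnd_apply_apply]

theorem envExtend_eq_zero_of_mem_relations (hf : ∀ (h : 𝔥) v, ρ h (f v) = f ⁅h, v⁆)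
    {a : 𝓤 𝔤 ⊗[R] V} (ha : a ∈ relations R 𝔥 V) : envExtend ρ f a = 0 := by
  induction ha using Submodule.span_induction with
  | zero => exact map_zero _
  | add a b _ _ ha hb => rw [map_add, ha, hb, add_zero]
  | smul u a _ ha => rw [envExtend_smul, ha, map_zero]
  | mem a ha =>
    obtain ⟨u, w, v, rfl⟩ := ha
    rw [map_sub, envExtend_tmul, envExtend_tmul, map_mul, Module.End.mul_apply,
      lift_envIncl_of_equivariant hf, sub_self]

theorem incl_injective_of_equivariant (hf : ∀ (h : 𝔥) v, ρ h (f v) = f ⁅h, v⁆)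
    (hinj : Function.Injective f) : Function.Injective (incl R 𝔥 V) := by
  refine (injective_iff_map_eq_zero _).mpr fun v hv => hinj ?_
  rw [map_zero, ← envExtend_one_tmul ρ f]
  exact envExtend_eq_zero_of_mem_relations hf
    ((Submodule.Quotient.mk_eq_zero (relations R 𝔥 V)).mp hv)

end Equivariant

theorem isIrreducible_ind [LieModule.IsIrreducible R 𝔥 V]
    (hinj : Function.Injective (incl R 𝔥 V))
    (hmeet : ∀ N : LieSubmodule R 𝔤 (Ind R 𝔥 V), N ≠ ⊥ → ∃ v ≠ 0, incl R 𝔥 V v ∈ N) :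
    LieModule.IsIrreducible R 𝔤 (Ind R 𝔥 V) := by
  have : Nontrivial V := LieModule.nontrivial_of_isIrreducible R 𝔥 V
  have : Nontrivial (Ind R 𝔥 V) := hinj.nontrivial
  refine LieModule.IsIrreducible.mk fun N hN => ?_
  let N' : LieSubmodule R 𝔥 V :=
    { N.toSubmodule.comap (incl R 𝔥 V) with
      lie_mem := fun {h v} hv => by
        change incl R 𝔥 V ⁅h, v⁆ ∈ N
        rw [← lie_incl]
        exact N.lie_mem hv }
  have hN' : N' = ⊤ := by
    obtain ⟨v, hv, hvN⟩ := hmeet N hN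
    exact (eq_bot_or_eq_top N').resolve_left fun h =>
      hv ((LieSubmodule.mem_bot v).mp (h ▸ show v ∈ N' from hvN))
  rw [← top_le_iff, ← lieSpan_range_incl, LieSubmodule.lieSpan_le]
  rintro _ ⟨v, rfl⟩
  exact show v ∈ N' from hN' ▸ LieSubmodule.mem_top v

end Incl

section Triangular

variable (𝔫 : LieSubalgebra R 𝔤) (V : Type*) [AddCommGroup V] [Module R V]

/-- The action `(n · ψ) x = n · ψ x - ψ ⁅n, x⁆` of `𝔫` on the linear maps from `𝔤` to the free
module `U(𝔫) ⊗ V`. -/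
noncomputable def jetAction : 𝔫 →ₗ⁅R⁆ Module.End R (𝔤 →ₗ[R] 𝓤 𝔫 ⊗[R] V) :=
  letI := LieRingModule.ofAssociativeModule (A := 𝓤 𝔫) (M := 𝓤 𝔫 ⊗[R] V)
  letI := LieModule.ofAssociativeModule (R := R) (A := 𝓤 𝔫) (M := 𝓤 𝔫 ⊗[R] V)
  letI := LieRingModule.compLieHom (𝓤 𝔫 ⊗[R] V) (ι R (L := 𝔫))
  letI := LieModule.compLieHom (𝓤 𝔫 ⊗[R] V) (ι R (L := 𝔫))
  LieModule.toEnd R 𝔫 (𝔤 →ₗ[R] 𝓤 𝔫 ⊗[R] V)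

theorem jetAction_apply (n : 𝔫) (ψ : 𝔤 →ₗ[R] 𝓤 𝔫 ⊗[R] V) (x : 𝔤) :
    jetAction 𝔫 V n ψ x = ι R n • ψ x - ψ ⁅(n : 𝔤), x⁆ := rfl

variable {𝔫 V} {𝔥 : LieSubalgebra R 𝔤} [LieRingModule 𝔥 V] [LieModule R 𝔥 V]
  (hc : IsCompl 𝔫.toSubmodule 𝔥.toSubmodule)

/-- The `𝔫`-component of an element of `𝔤 = 𝔫 ⊕ 𝔥`. -/
noncomputable def projLeft : 𝔤 →ₗ[R] 𝔫 := Submodule.projectionOnto _ _ hc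

/-- The `𝔥`-component of an element of `𝔤 = 𝔫 ⊕ 𝔥`. -/
noncomputable def projRight : 𝔤 →ₗ[R] 𝔥 := Submodule.projectionOnto _ _ hc.symm

theorem projLeft_left (n : 𝔫) : projLeft hc n = n := Submodule.projectionOnto_apply_left hc n

theorem projLeft_right (h : 𝔥) : projLeft hc h = 0 := Submodule.projectionOnto_apply_right hc h

theorem projRight_left (n : 𝔫) : projRight hc n = 0 :=
  Submodule.projectionOnto_apply_right hc.symm n

theorem projRight_right (h : 𝔥) : projRight hc h = h :=
  Submodule.projectionOnto_apply_left hc.symm h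

theorem projLeft_add_projRight (x : 𝔤) : (projLeft hc x : 𝔤) + projRight hc x = x :=
  Submodule.projection_add_projection_eq_self hc x

variable (V) in
/-- The map `v ↦ (x ↦ x · (1 ⊗ v))` that prescribes the action of `𝔤 = 𝔫 ⊕ 𝔥` on `1 ⊗ V`. -/
noncomputable def jetBase : V →ₗ[R] 𝔤 →ₗ[R] 𝓤 𝔫 ⊗[R] V :=
  LinearMap.mk₂ R (fun v x => ι R (projLeft hc x) ⊗ₜ v + 1 ⊗ₜ ⁅projRight hc x, v⁆)
    (fun v w x => by simp only [lie_add, TensorProduct.tmul_add]; abel)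
    (fun t v x => by simp only [lie_smul, TensorProduct.tmul_smul, smul_add])
    (fun v x y => by
      simp only [map_add, add_lie, TensorProduct.tmul_add, TensorProduct.add_tmul]; abel)
    (fun t v x => by
      simp only [map_smul, smul_lie, TensorProduct.tmul_smul, TensorProduct.smul_tmul', smul_add])

variable (V) in
/-- The map `a ↦ (x ↦ x · a)`, the `𝔫`-equivariant extension of `jetBase` to `U(𝔫) ⊗ V`. -/
noncomputable def jet : 𝓤 𝔫 ⊗[R] V →ₗ[R] 𝔤 →ₗ[R] 𝓤 𝔫 ⊗[R] V :=
  envExtend (jetAction 𝔫 V) (jetBase V hc)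

theorem jet_one_tmul (v : V) (x : 𝔤) :
    jet V hc (1 ⊗ₜ v) x = ι R (projLeft hc x) ⊗ₜ v + 1 ⊗ₜ ⁅projRight hc x, v⁆ := by
  rw [jet, envExtend_one_tmul]
  rfl

theorem jet_one_tmul_right (v : V) (h : 𝔥) : jet V hc (1 ⊗ₜ v) h = 1 ⊗ₜ ⁅h, v⁆ := by
  rw [jet_one_tmul, projLeft_right, projRight_right, map_zero, TensorProduct.zero_tmul, zero_add]

theorem jet_smul (n : 𝔫) (a : 𝓤 𝔫 ⊗[R] V) (x : 𝔤) :
    jet V hc (ι R n • a) x = ι R n • jet V hc a x - jet V hc a ⁅(n : 𝔤), x⁆ := by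
  rw [jet, envExtend_ι_smul, jetAction_apply]

theorem jet_left (n : 𝔫) (a : 𝓤 𝔫 ⊗[R] V) : jet V hc a n = ι R n • a := by
  induction a using env_tmul_induction generalizing n with
  | one v =>
    rw [jet_one_tmul, projLeft_left, projRight_left, zero_lie, TensorProduct.tmul_zero, add_zero,
      TensorProduct.smul_tmul', smul_eq_mul, mul_one]
  | add a b ha hb => rw [map_add, LinearMap.add_apply, ha, hb, smul_add]
  | smul t a ha => rw [map_smul, LinearMap.smul_apply, ha, smul_comm]
  | mul n' a ha =>
    rw [jet_smul, ha, ← LieSubalgebra.coe_bracket, ha, LieHom.map_lie,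
      LieRing.of_associative_ring_bracket, sub_smul, mul_smul, mul_smul, sub_sub_cancel]

theorem jet_left_lie (n : 𝔫) (y : 𝔤) (a : 𝓤 𝔫 ⊗[R] V) :
    jet V hc a ⁅(n : 𝔤), y⁆ = jet V hc (jet V hc a y) n - jet V hc (jet V hc a n) y := by
  rw [jet_left, jet_left, jet_smul, sub_sub_cancel]

theorem jet_one_tmul_lie (x y : 𝔤) (v : V) :
    jet V hc (1 ⊗ₜ v) ⁅x, y⁆ =
      jet V hc (jet V hc (1 ⊗ₜ v) y) x - jet V hc (jet V hc (1 ⊗ₜ v) x) y := by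
  have right_right (h h' : 𝔥) : jet V hc (1 ⊗ₜ v) ⁅(h : 𝔤), (h' : 𝔤)⁆ =
      jet V hc (jet V hc (1 ⊗ₜ v) h') h - jet V hc (jet V hc (1 ⊗ₜ v) h) h' := by
    simp only [← LieSubalgebra.coe_bracket, jet_one_tmul_right]
    rw [← TensorProduct.tmul_sub, lie_lie]
  have right_left (h : 𝔥) (n : 𝔫) : jet V hc (1 ⊗ₜ v) ⁅(h : 𝔤), (n : 𝔤)⁆ =
      jet V hc (jet V hc (1 ⊗ₜ v) n) h - jet V hc (jet V hc (1 ⊗ₜ v) h) n := by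
    rw [← lie_skew, map_neg, jet_left_lie, neg_sub]
  rw [← projLeft_add_projRight hc x, ← projLeft_add_projRight hc y]
  generalize projLeft hc x = n, projRight hc x = h, projLeft hc y = n', projRight hc y = h'
  simp only [add_lie, lie_add, map_add, LinearMap.add_apply, jet_left_lie, right_right, right_left]
  abel

theorem jet_lie (x y : 𝔤) (a : 𝓤 𝔫 ⊗[R] V) :
    jet V hc a ⁅x, y⁆ = jet V hc (jet V hc a y) x - jet V hc (jet V hc a x) y := by
  induction a using env_tmul_induction generalizing x y with
  | one v => exact jet_one_tmul_lie hc x y v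
  | add a b ha hb => simp only [map_add, LinearMap.add_apply, ha, hb]; abel
  | smul t a ha => simp only [map_smul, LinearMap.smul_apply, ha, smul_sub]
  | mul n a ha =>
    simp only [jet_smul, map_sub, LinearMap.sub_apply, ha, leibniz_lie (n : 𝔤) x y, map_add,
      smul_sub]
    abel

variable (V) in
/-- The action of `𝔤 = 𝔫 ⊕ 𝔥` on `U(𝔫) ⊗ V`. -/
noncomputable def triangAction : 𝔤 →ₗ⁅R⁆ Module.End R (𝓤 𝔫 ⊗[R] V) where
  __ := (jet V hc).flip
  map_lie' {x y} := LinearMap.ext fun a => jet_lie hc x y a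

include hc in
theorem incl_injective_of_isCompl : Function.Injective (incl R 𝔥 V) :=
  incl_injective_of_equivariant (ρ := triangAction V hc) (f := TensorProduct.mk R (𝓤 𝔫) V 1)
    (fun h v => jet_one_tmul_right hc v h) env_one_tmul_injective

end Triangular

end Enveloping

section Words

variable {R : Type*} [CommRing R] {𝔤 : Type*} [LieRing 𝔤] [LieAlgebra R 𝔤]
  {M : Type*} [AddCommGroup M] [Module R M] [LieRingModule 𝔤 M] [LieModule R 𝔤 M]
  {V : Type*} [AddCommGroup V] [Module R V] {X : Type*}

section Span

variable (e : X → 𝔤) (φ : V →ₗ[R] M)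

/-- The map `v ↦ e(x₁) ⋯ e(xᵣ) φ(v)` attached to a word `x₁ ⋯ xᵣ` in an alphabet `X` whose
letters `x` stand for the elements `e x` of the Lie algebra. -/
def wordMap : List X → V →ₗ[R] M
  | [] => φ
  | x :: w => LieModule.toEnd R 𝔤 M (e x) ∘ₗ wordMap w

/-- The linear combination of words with coefficients in `V` (standing on the right). -/
noncomputable def wordSum : (List X →₀ V) →ₗ[R] M := Finsupp.lsum R (wordMap e φ)

/-- The span of the words in a set `P`, with all coefficients in `V`. -/
noncomputable def wordSpan (P : Set (List X)) : Submodule R M :=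
  (Finsupp.supported V R P).map (wordSum e φ)

variable {e φ}

theorem wordMap_nil (v : V) : wordMap e φ [] v = φ v := rfl

theorem wordMap_cons (x : X) (w : List X) (v : V) :
    wordMap e φ (x :: w) v = ⁅e x, wordMap e φ w v⁆ := rfl

theorem wordSum_single (w : List X) (v : V) :
    wordSum e φ (Finsupp.single w v) = wordMap e φ w v := Finsupp.lsum_single _ _ _ _

theorem wordMap_mem_wordSpan {P : Set (List X)} {w : List X} (hw : w ∈ P) (v : V) :
    wordMap e φ w v ∈ wordSpan e φ P :=
  ⟨Finsupp.single w v, Finsupp.single_mem_supported R v hw, wordSum_single w v⟩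

theorem wordSpan_le {P : Set (List X)} {N : Submodule R M} :
    wordSpan e φ P ≤ N ↔ ∀ w ∈ P, ∀ v, wordMap e φ w v ∈ N := by
  refine ⟨fun h w hw v => h (wordMap_mem_wordSpan hw v), ?_⟩
  rintro h _ ⟨f, hf, rfl⟩
  exact N.sum_mem fun w hw => h w (hf hw) _

theorem wordSpan_mono {P Q : Set (List X)} (h : P ⊆ Q) : wordSpan e φ P ≤ wordSpan e φ Q :=
  wordSpan_le.mpr fun _ hw v => wordMap_mem_wordSpan (h hw) v

theorem wordSpan_eq_bot {P : Set (List X)} (h : P = ∅) : wordSpan e φ P = ⊥ := by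
  rw [wordSpan, h, Finsupp.supported_empty, Submodule.map_bot]

theorem letter_lie_mem_wordSpan {P Q : Set (List X)} {x : X} (h : ∀ w ∈ P, x :: w ∈ Q) {y : M}
    (hy : y ∈ wordSpan e φ P) : ⁅e x, y⁆ ∈ wordSpan e φ Q :=
  (wordSpan_le (N := (wordSpan e φ Q).comap (LieModule.toEnd R 𝔤 M (e x)))).mpr
    (fun w hw v => wordMap_mem_wordSpan (h w hw) v) hy

end Span

section Sorting

variable {e : X → 𝔤} {φ : V →ₗ[R] M} {wt : X → ℕ}

theorem lie_wordMap_mem_wordSpan {w : List X} {s : Set X} {g : 𝔤}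
    (hg : g ∈ Submodule.span R (e '' s)) (v : V) :
    ⁅g, wordMap e φ w v⁆ ∈ wordSpan e φ {u | ∃ z ∈ s, u = z :: w} := by
  refine Submodule.span_le (p := (wordSpan e φ {u | ∃ z ∈ s, u = z :: w}).comap
    ((LieModule.toEnd R 𝔤 M : 𝔤 →ₗ[R] Module.End R M).flip (wordMap e φ w v))).mpr ?_ hg
  rintro _ ⟨z, hz, rfl⟩
  refine wordMap_mem_wordSpan (w := z :: w) ?_ v
  exact ⟨z, hz, rfl⟩

theorem wordMap_sub_wordMap_mem_of_perm
    (hlie : ∀ x y, ⁅e x, e y⁆ ∈ Submodule.span R (e '' {z | wt z = wt x + wt y}))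
    {w w' : List X} (h : w.Perm w') (v : V) :
    wordMap e φ w v - wordMap e φ w' v ∈
      wordSpan e φ {u | u.length < w.length ∧ (u.map wt).sum = (w.map wt).sum} := by
  induction h with
  | nil => rw [sub_self]; exact zero_mem _
  | cons x _ ih =>
    rw [wordMap_cons, wordMap_cons, ← lie_sub]
    refine letter_lie_mem_wordSpan (fun u hu => ?_) ih
    simpa only [Set.mem_ofPred_eq, List.length_cons, List.map_cons, List.sum_cons,
      add_lt_add_iff_right, add_right_inj] using hu
  | swap x y w =>
    simp only [wordMap_cons, ← lie_lie]
    refine wordSpan_mono ?_ (lie_wordMap_mem_wordSpan (hlie y x) v)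
    rintro _ ⟨z, hz, rfl⟩
    refine ⟨Nat.lt_succ_self _, ?_⟩
    simp only [List.map_cons, List.sum_cons, hz.out, add_assoc]
  | trans h₁ _ ih₁ ih₂ =>
    rw [← h₁.length_eq, ← (h₁.map wt).sum_eq] at ih₂
    simpa only [sub_add_sub_cancel] using add_mem ih₁ ih₂

variable [LinearOrder X]

theorem wordMap_mem_wordSpan_sorted
    (hlie : ∀ x y, ⁅e x, e y⁆ ∈ Submodule.span R (e '' {z | wt z = wt x + wt y}))
    (w : List X) (v : V) :
    wordMap e φ w v ∈ wordSpan e φ {u | u.SortedLE ∧ (u.map wt).sum = (w.map wt).sum} := by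
  induction hr : w.length using Nat.strong_induction_on generalizing w v with
  | _ r ih =>
    subst hr
    have hperm := w.mergeSort_perm (· ≤ ·)
    have hsort : wordMap e φ (w.mergeSort (· ≤ ·)) v ∈
        wordSpan e φ {u | u.SortedLE ∧ (u.map wt).sum = (w.map wt).sum} :=
      wordMap_mem_wordSpan (.intro w.sortedLE_mergeSort (hperm.map wt).sum_eq) v
    refine (Submodule.sub_mem_iff_left _ hsort).mp (wordSpan_le.mpr (fun u hu v => ?_)
      (wordMap_sub_wordMap_mem_of_perm hlie hperm.symm v))
    rw [← hu.2]
    exact ih _ hu.1 u v rfl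

end Sorting

section Filtration

variable (e : X → 𝔤) (φ : V →ₗ[R] M) (wt : X → ℕ)

/-- The span of the words of weight at most `q`; it vanishes for `q < 0`. -/
noncomputable def wordFiltration (q : ℤ) : Submodule R M :=
  wordSpan e φ {w | ((w.map wt).sum : ℤ) ≤ q}

/-- The elements of the Lie algebra whose action raises the filtration by weight by at most `k`,
where `k` may be negative. -/
def shift (k : ℤ) : Submodule R 𝔤 where
  carrier := {g | ∀ q, ∀ y ∈ wordFiltration e φ wt q, ⁅g, y⁆ ∈ wordFiltration e φ wt (q + k)}
  zero_mem' q y _ := by rw [zero_lie]; exact zero_mem _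
  add_mem' ha hb q y hy := by rw [add_lie]; exact add_mem (ha q y hy) (hb q y hy)
  smul_mem' t g hg q y hy := by rw [smul_lie]; exact Submodule.smul_mem _ t (hg q y hy)

variable {e φ wt}

theorem wordFiltration_mono : Monotone (wordFiltration e φ wt) :=
  fun _ _ h => wordSpan_mono fun _ hw => hw.out.trans h

theorem wordFiltration_eq_bot {q : ℤ} (hq : q < 0) : wordFiltration e φ wt q = ⊥ :=
  wordSpan_eq_bot (Set.eq_empty_of_forall_notMem fun _ hw =>
    hq.not_ge ((Int.natCast_nonneg _).trans hw.out))

theorem wordMap_mem_wordFiltration (w : List X) (v : V) :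
    wordMap e φ w v ∈ wordFiltration e φ wt (w.map wt).sum :=
  wordMap_mem_wordSpan (P := {u | ((u.map wt).sum : ℤ) ≤ _}) (Set.mem_ofPred.mpr le_rfl) v

theorem map_mem_wordFiltration_zero (v : V) : φ v ∈ wordFiltration e φ wt 0 :=
  wordMap_mem_wordFiltration [] v

theorem lie_mem_wordFiltration {g : 𝔤} {k q r : ℤ} (hg : g ∈ shift e φ wt k) {y : M}
    (hy : y ∈ wordFiltration e φ wt q) (h : q + k ≤ r) : ⁅g, y⁆ ∈ wordFiltration e φ wt r :=
  wordFiltration_mono h (hg q y hy)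

theorem shift_mono : Monotone (shift e φ wt) :=
  fun _ _ h _ hg _ _ hy => lie_mem_wordFiltration hg hy (by lia)

theorem letter_mem_shift (x : X) : e x ∈ shift e φ wt (wt x) :=
  fun _ _ hy => letter_lie_mem_wordSpan
    (fun w hw => by
      rw [Set.mem_ofPred_eq, List.map_cons, List.sum_cons, Nat.cast_add, add_comm]
      exact add_le_add_left hw.out _) hy

theorem mem_shift {g : 𝔤} {k : ℤ}
    (h : ∀ w v, ⁅g, wordMap e φ w v⁆ ∈ wordFiltration e φ wt ((w.map wt).sum + k)) :
    g ∈ shift e φ wt k := fun q _ hy =>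
  (wordSpan_le (N := (wordFiltration e φ wt (q + k)).comap (LieModule.toEnd R 𝔤 M g))).mpr
    (fun w hw v => wordFiltration_mono (add_le_add_left hw.out k) (h w v)) hy

theorem mem_shift_of_letter {g : 𝔤} {k : ℤ} (hφ : ∀ v, ⁅g, φ v⁆ ∈ wordFiltration e φ wt k)
    (he : ∀ x, ⁅g, e x⁆ ∈ shift e φ wt (k + wt x)) : g ∈ shift e φ wt k := by
  refine mem_shift fun w v => ?_
  induction w with
  | nil => simpa only [wordMap_nil, List.map_nil, List.sum_nil, Nat.cast_zero, zero_add] using hφ v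
  | cons x w ih =>
    rw [wordMap_cons, leibniz_lie, List.map_cons, List.sum_cons, Nat.cast_add]
    exact add_mem (lie_mem_wordFiltration (he x) (wordMap_mem_wordFiltration w v) (by lia))
      (lie_mem_wordFiltration (letter_mem_shift x) ih (by lia))

theorem lie_wordMap_sub_wordMap_mem {g : 𝔤} {T : V →ₗ[R] V} (hφ : ∀ v, ⁅g, φ v⁆ = φ (T v))
    (he : ∀ x, ⁅g, e x⁆ ∈ shift e φ wt (wt x - 1)) (w : List X) (v : V) :
    ⁅g, wordMap e φ w v⁆ - wordMap e φ w (T v) ∈ wordFiltration e φ wt ((w.map wt).sum - 1) := by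
  induction w with
  | nil => rw [wordMap_nil, wordMap_nil, hφ, sub_self]; exact zero_mem _
  | cons x w ih =>
    rw [wordMap_cons, wordMap_cons, leibniz_lie, add_sub_assoc, ← lie_sub, List.map_cons,
      List.sum_cons, Nat.cast_add]
    exact add_mem (lie_mem_wordFiltration (he x) (wordMap_mem_wordFiltration w v) (by lia))
      (lie_mem_wordFiltration (letter_mem_shift x) ih (by lia))

theorem exists_mem_wordFiltration
    (hspan : LieSubmodule.lieSpan R 𝔤 (Set.range φ) = ⊤) (hshift : ∀ g, ∃ k, g ∈ shift e φ wt k)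
    (y : M) : ∃ q, y ∈ wordFiltration e φ wt q := by
  have mem_iSup {y : M} : y ∈ ⨆ q, wordFiltration e φ wt q ↔ ∃ q, y ∈ wordFiltration e φ wt q :=
    Submodule.mem_iSup_of_directed _ wordFiltration_mono.directed_le
  let N : LieSubmodule R 𝔤 M :=
    { ⨆ q, wordFiltration e φ wt q with
      lie_mem := fun {g y} hy => by
        obtain ⟨q, hq⟩ := mem_iSup.mp hy
        obtain ⟨k, hk⟩ := hshift g
        exact mem_iSup.mpr ⟨q + k, hk q y hq⟩ }
  have hN : LieSubmodule.lieSpan R 𝔤 (Set.range φ) ≤ N := by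
    refine LieSubmodule.lieSpan_le.mpr ?_
    rintro _ ⟨v, rfl⟩
    exact mem_iSup.mpr ⟨0, map_mem_wordFiltration_zero v⟩
  exact mem_iSup.mp (hN (hspan ▸ LieSubmodule.mem_top y))

theorem exists_mem_notMem_wordFiltration {y : M} (hy0 : y ≠ 0) {q : ℤ}
    (hq : y ∈ wordFiltration e φ wt q) :
    ∃ n : ℕ, y ∈ wordFiltration e φ wt n ∧ y ∉ wordFiltration e φ wt (n - 1) := by
  by_contra! hdesc
  have hnot (n : ℕ) : y ∉ wordFiltration e φ wt n := by
    induction n with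
    | zero =>
      intro hy
      have hneg := hdesc 0 hy
      rw [wordFiltration_eq_bot (by lia), Submodule.mem_bot] at hneg
      exact hy0 hneg
    | succ n ih => exact fun hy => ih (wordFiltration_mono (by lia) (hdesc _ hy))
  exact hnot _ (wordFiltration_mono q.self_le_toNat hq)

theorem wordFiltration_le_sorted_sup [LinearOrder X]
    (hlie : ∀ x y, ⁅e x, e y⁆ ∈ Submodule.span R (e '' {z | wt z = wt x + wt y})) (n : ℕ) :
    wordFiltration e φ wt n ≤
      wordSpan e φ {w | w.SortedLE ∧ (w.map wt).sum = n} ⊔ wordFiltration e φ wt (n - 1) := by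
  refine wordSpan_le.mpr fun w hw v => ?_
  obtain hlt | heq := hw.out.lt_or_eq
  · exact Submodule.mem_sup_right
      (wordFiltration_mono (Int.le_sub_one_of_lt hlt) (wordMap_mem_wordFiltration w v))
  · rw [Nat.cast_inj] at heq
    exact Submodule.mem_sup_left (heq ▸ wordMap_mem_wordSpan_sorted hlie w v)

end Filtration

section FormalDerivative

variable [DecidableEq X] (x : X) (T : V →ₗ[R] V)

/-- The formal derivative `∂/∂x` of a combination of words, followed by the endomorphism `T` of the
coefficients. It is meant for sorted words in letters that are at least `x`, where it removes a
letter `x` from the front, with the exponent of `x` as a factor. -/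
noncomputable def formalDeriv : (List X →₀ V) →ₗ[R] (List X →₀ V) where
  toFun f := Finsupp.onFinset (f.support.preimage (List.cons x) List.cons_injective.injOn)
    (fun w => ((x :: w).count x) • T (f (x :: w))) fun w hw => by
      rw [Finset.mem_preimage, Finsupp.mem_support_iff]
      rintro h
      rw [h, map_zero, smul_zero] at hw
      exact hw rfl
  map_add' f g := by
    ext w
    simp only [Finsupp.onFinset_apply, Finsupp.add_apply, map_add, smul_add]
  map_smul' t f := by
    ext w
    simp only [Finsupp.onFinset_apply, Finsupp.smul_apply, map_smul, RingHom.id_apply,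
      smul_comm t]

variable {x T}

theorem formalDeriv_apply (f : List X →₀ V) (w : List X) :
    formalDeriv x T f w = ((x :: w).count x) • T (f (x :: w)) := rfl

theorem formalDeriv_single_cons (w : List X) (v : V) :
    formalDeriv x T (Finsupp.single (x :: w) v) = Finsupp.single w ((x :: w).count x • T v) := by
  ext u
  rw [formalDeriv_apply]
  obtain rfl | h := eq_or_ne w u
  · rw [Finsupp.single_eq_same, Finsupp.single_eq_same]
  · rw [Finsupp.single_eq_of_ne' h, Finsupp.single_eq_of_ne' (List.cons_injective.ne h), map_zero,
      smul_zero]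

theorem formalDeriv_single_of_notMem {w : List X} (hw : x ∉ w) (v : V) :
    formalDeriv x T (Finsupp.single w v) = 0 := by
  ext u
  rw [formalDeriv_apply, Finsupp.single_eq_of_ne, map_zero, smul_zero, Finsupp.zero_apply]
  rintro rfl
  exact hw List.mem_cons_self

theorem formalDeriv_ne_zero [IsAddTorsionFree V] (hT : Function.Injective T) {f : List X →₀ V}
    {w : List X} (hw : f (x :: w) ≠ 0) : formalDeriv x T f ≠ 0 := by
  refine DFunLike.ne_iff.mpr ⟨w, ?_⟩
  rw [formalDeriv_apply, Finsupp.zero_apply]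
  exact smul_ne_zero (List.count_pos_iff.mpr List.mem_cons_self).ne'
    ((map_ne_zero_iff T hT).mpr hw)

theorem formalDeriv_mem_supported {P Q : Set (List X)} (h : ∀ w, x :: w ∈ P → w ∈ Q)
    {f : List X →₀ V} (hf : f ∈ Finsupp.supported V R P) :
    formalDeriv x T f ∈ Finsupp.supported V R Q := fun w hw => by
  refine h w (hf (Finsupp.mem_support_iff.mpr fun h0 => Finsupp.mem_support_iff.mp hw ?_))
  rw [formalDeriv_apply, h0, map_zero, smul_zero]

end FormalDerivative

section Detector

variable [LinearOrder X]

/-- An element `g` of the Lie algebra detects the letter `x` if `g` acts on the words in letters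
that are at least `x` as the derivative `∂/∂x` followed by the injective endomorphism `T` of the
coefficients, up to words of lower weight. -/
structure IsDetector (e : X → 𝔤) (φ : V →ₗ[R] M) (wt : X → ℕ) (x : X) (g : 𝔤)
    (T : V →ₗ[R] V) : Prop where
  mem_shift : g ∈ shift e φ wt (-wt x)
  injective : Function.Injective T
  lie_lie_map (v : V) : ⁅⁅g, e x⁆, φ v⁆ = φ (T v)
  lie_lie_letter_mem (y : X) : ⁅⁅g, e x⁆, e y⁆ ∈ shift e φ wt (wt y - 1)
  lie_letter_mem (y : X) : x < y → ⁅g, e y⁆ ∈ shift e φ wt (wt y - wt x - 1)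

variable {e : X → 𝔤} {φ : V →ₗ[R] M} {wt : X → ℕ} {x : X} {g : 𝔤} {T : V →ₗ[R] V}

theorem notMem_or_eq_cons_erase {w : List X} (hsort : w.SortedLE) (hw : ∀ y ∈ w, x ≤ y) :
    x ∉ w ∨ w = x :: w.erase x := by
  cases w with
  | nil => exact .inl List.not_mem_nil
  | cons y w =>
    obtain rfl | hlt := (hw y List.mem_cons_self).eq_or_lt
    · exact .inr (by rw [List.erase_cons_head])
    · refine .inl fun hx => ?_
      obtain rfl | hx := List.mem_cons.mp hx
      · exact hlt.false
      · exact hlt.not_ge (List.rel_of_pairwise_cons hsort.pairwise hx)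

theorem letter_lie_wordMap_erase {w : List X} (hsort : w.SortedLE) (hw : ∀ y ∈ w, x ≤ y) (v : V) :
    ⁅e x, wordMap e φ (w.erase x) (w.count x • v)⁆ = wordMap e φ w (w.count x • v) := by
  obtain hx | hx := notMem_or_eq_cons_erase hsort hw
  · rw [List.count_eq_zero_of_not_mem hx, zero_smul, map_zero, map_zero, lie_zero]
  · rw [← wordMap_cons, ← hx]

theorem IsDetector.lie_wordMap_sub_mem (hg : IsDetector e φ wt x g T) (hx : 0 < wt x)
    {w : List X} (hsort : w.SortedLE) (hw : ∀ y ∈ w, x ≤ y) (v : V) :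
    ⁅g, wordMap e φ w v⁆ - wordMap e φ (w.erase x) (w.count x • T v) ∈
      wordFiltration e φ wt ((w.map wt).sum - wt x - 1) := by
  induction w with
  | nil =>
    have hg0 : ⁅g, wordMap e φ [] v⁆ ∈ wordFiltration e φ wt (-wt x) :=
      lie_mem_wordFiltration hg.mem_shift (map_mem_wordFiltration_zero v) (zero_add _).le
    rw [wordFiltration_eq_bot (by lia), Submodule.mem_bot] at hg0
    rw [hg0, List.count_nil, zero_smul, map_zero, sub_zero]
    exact zero_mem _
  | cons y w ih =>
    have hsort' : w.SortedLE := hsort.pairwise.of_cons.sortedLE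
    have hw' : ∀ z ∈ w, x ≤ z := fun z hz => hw z (List.mem_cons_of_mem y hz)
    have hrest := letter_mem_shift (φ := φ) (wt := wt) (e := e) y _ _ (ih hsort' hw')
    rw [wordMap_cons, leibniz_lie, List.map_cons, List.sum_cons, Nat.cast_add]
    obtain rfl | hlt := (hw y List.mem_cons_self).eq_or_lt
    · have hhead := lie_wordMap_sub_wordMap_mem hg.lie_lie_map hg.lie_lie_letter_mem w v
      rw [lie_sub, letter_lie_wordMap_erase hsort' hw'] at hrest
      rw [List.erase_cons_head, List.count_cons_self, succ_nsmul', map_add, add_sub_add_comm]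
      exact add_mem (wordFiltration_mono (by lia) hhead) (wordFiltration_mono (by lia) hrest)
    · rw [List.erase_cons_tail (by simpa using hlt.ne'), List.count_cons_of_ne hlt.ne',
        wordMap_cons, add_sub_assoc ⁅⁅g, e y⁆, _⁆, ← lie_sub]
      exact add_mem (lie_mem_wordFiltration (hg.lie_letter_mem y hlt)
        (wordMap_mem_wordFiltration w v) (by lia)) (wordFiltration_mono (by lia) hrest)

theorem wordSum_formalDeriv_single {w : List X} (hsort : w.SortedLE) (hw : ∀ y ∈ w, x ≤ y) (v : V) :
    wordSum e φ (formalDeriv x T (Finsupp.single w v)) =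
      wordMap e φ (w.erase x) (w.count x • T v) := by
  obtain hx | hx := notMem_or_eq_cons_erase hsort hw
  · rw [formalDeriv_single_of_notMem hx, List.count_eq_zero_of_not_mem hx, zero_smul, map_zero,
      map_zero]
  · conv_lhs => rw [hx, formalDeriv_single_cons, wordSum_single, ← hx]

theorem IsDetector.lie_wordSum_sub_mem (hg : IsDetector e φ wt x g T) (hx : 0 < wt x) {n : ℕ}
    {f : List X →₀ V} (hf : f ∈ Finsupp.supported V R
      {w | (w.SortedLE ∧ (w.map wt).sum = n) ∧ ∀ y ∈ w, x ≤ y}) :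
    ⁅g, wordSum e φ f⁆ - wordSum e φ (formalDeriv x T f) ∈
      wordFiltration e φ wt (n - wt x - 1) := by
  let N := (wordFiltration e φ wt (n - wt x - 1)).comap
    (LieModule.toEnd R 𝔤 M g ∘ₗ wordSum e φ - wordSum e φ ∘ₗ formalDeriv x T)
  suffices h : f ∈ N from h
  rw [← f.sum_single]
  refine N.sum_mem fun w hw => ?_
  obtain ⟨⟨hsort, rfl⟩, hle⟩ := hf hw
  change ⁅g, wordSum e φ (Finsupp.single w (f w))⁆ - wordSum e φ (formalDeriv x T _) ∈
    wordFiltration e φ wt _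
  rw [wordSum_single, wordSum_formalDeriv_single hsort hle]
  exact hg.lie_wordMap_sub_mem hx hsort hle _

theorem IsDetector.exists_formalDeriv_add_mem [IsAddTorsionFree V] (hg : IsDetector e φ wt x g T)
    (hx : 0 < wt x) {N : LieSubmodule R 𝔤 M} {n : ℕ} {f : List X →₀ V}
    (hf : f ∈ Finsupp.supported V R {w | w.SortedLE ∧ (w.map wt).sum = n})
    (hle : ∀ w ∈ f.support, ∀ y ∈ w, x ≤ y) (hmem : ∃ w ∈ f.support, x ∈ w)
    {y : M} (hy : y ∈ wordFiltration e φ wt (n - 1)) (hN : wordSum e φ f + y ∈ N) :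
    ∃ n' < n, ∃ f' ∈ Finsupp.supported V R {w | w.SortedLE ∧ (w.map wt).sum = n'}, f' ≠ 0 ∧
      ∃ y' ∈ wordFiltration e φ wt (n' - 1), wordSum e φ f' + y' ∈ N := by
  obtain ⟨w, hw, hxw⟩ := hmem
  obtain ⟨hsort, hsum⟩ := hf hw
  have hcons := (notMem_or_eq_cons_erase hsort (hle w hw)).resolve_left (not_not_intro hxw)
  have hn : wt x ≤ n := hsum ▸ List.single_le_sum (fun _ _ => zero_le) _ (List.mem_map_of_mem hxw)
  refine ⟨n - wt x, by lia, formalDeriv x T f, formalDeriv_mem_supported (fun u hu => ?_) hf,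
    formalDeriv_ne_zero (w := w.erase x) hg.injective
      (hcons ▸ Finsupp.mem_support_iff.mp hw),
    ⁅g, wordSum e φ f⁆ - wordSum e φ (formalDeriv x T f) + ⁅g, y⁆, ?_, ?_⟩
  · obtain ⟨hu, hsum⟩ := hu
    rw [List.map_cons, List.sum_cons] at hsum
    exact ⟨hu.pairwise.of_cons.sortedLE, by lia⟩
  · exact add_mem
      (wordFiltration_mono (by lia) (hg.lie_wordSum_sub_mem hx fun w hw => ⟨hf hw, hle w hw⟩))
      (lie_mem_wordFiltration hg.mem_shift hy (by lia))
  · rw [← add_assoc, add_sub_cancel, ← lie_add]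
    exact N.lie_mem hN

theorem exists_map_mem_of_wordSum_add_mem [IsAddTorsionFree V]
    (hwt : ∀ x, 0 < wt x) (hdet : ∀ x, ∃ g T, IsDetector e φ wt x g T)
    (N : LieSubmodule R 𝔤 M) (n : ℕ) {f : List X →₀ V} (hf0 : f ≠ 0)
    (hf : f ∈ Finsupp.supported V R {w | w.SortedLE ∧ (w.map wt).sum = n})
    {y : M} (hy : y ∈ wordFiltration e φ wt (n - 1)) (hN : wordSum e φ f + y ∈ N) :
    ∃ v ≠ 0, φ v ∈ N := by
  induction n using Nat.strong_induction_on generalizing f y with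
  | _ n ih =>
  let letters : Finset X := f.support.biUnion List.toFinset
  have mem_letters {x : X} : x ∈ letters ↔ ∃ w ∈ f.support, x ∈ w := by
    simp only [letters, Finset.mem_biUnion, List.mem_toFinset]
  obtain hempty | hne := letters.eq_empty_or_nonempty
  · have hnil : ∀ w ∈ f.support, w = [] := fun w hw => List.eq_nil_iff_forall_not_mem.mpr
      fun x hx => Finset.notMem_empty x (hempty ▸ mem_letters.mpr ⟨w, hw, hx⟩)
    obtain ⟨w, hw⟩ := Finsupp.support_nonempty_iff.mpr hf0
    obtain rfl := hnil w hw
    obtain rfl : 0 = n := (hf hw).2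
    rw [wordFiltration_eq_bot (by lia), Submodule.mem_bot] at hy
    rw [Finsupp.support_subset_singleton.mp fun u hu => Finset.mem_singleton.mpr (hnil u hu),
      wordSum_single, hy, add_zero] at hN
    exact ⟨f [], Finsupp.mem_support_iff.mp hw, hN⟩
  · obtain ⟨g, T, hg⟩ := hdet (letters.min' hne)
    obtain ⟨n', hn', f', hf', hf0', y', hy', hN'⟩ := hg.exists_formalDeriv_add_mem (hwt _) hf
      (fun w hw y hy => letters.min'_le y (mem_letters.mpr ⟨w, hw, hy⟩))
      (mem_letters.mp (letters.min'_mem hne)) hy hN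
    exact ih n' hn' hf0' hf' hy' hN'

theorem exists_map_mem_of_ne_bot [IsAddTorsionFree V] (hwt : ∀ x, 0 < wt x)
    (hlie : ∀ x y, ⁅e x, e y⁆ ∈ Submodule.span R (e '' {z | wt z = wt x + wt y}))
    (hspan : LieSubmodule.lieSpan R 𝔤 (Set.range φ) = ⊤) (hshift : ∀ g, ∃ k, g ∈ shift e φ wt k)
    (hdet : ∀ x, ∃ g T, IsDetector e φ wt x g T) {N : LieSubmodule R 𝔤 M} (hN : N ≠ ⊥) :
    ∃ v ≠ 0, φ v ∈ N := by
  obtain ⟨y, hyN, hy0⟩ : ∃ y ∈ N, y ≠ 0 := by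
    simpa only [ne_eq, LieSubmodule.eq_bot_iff, not_forall, exists_prop] using hN
  obtain ⟨q, hq⟩ := exists_mem_wordFiltration hspan hshift y
  obtain ⟨n, hn, hn'⟩ := exists_mem_notMem_wordFiltration hy0 hq
  obtain ⟨_, ⟨f, hf, rfl⟩, y', hy', rfl⟩ :=
    Submodule.mem_sup.mp (wordFiltration_le_sorted_sup hlie n hn)
  refine exists_map_mem_of_wordSum_add_mem hwt hdet N n ?_ hf hy' hyN
  rintro rfl
  exact hn' (by rwa [map_zero, zero_add])

end Detector

end Words

section Graded

variable {A : Type*}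

/-- The weight `p` of the pair `(p, a)`, which stands for the letter `gen a (-p)`. The pairs are
ordered lexicographically. -/
def weight (x : ℕ+ ×ₗ A) : ℕ := (ofLex x).1

/-- The letter `gen a (-p)` indexed by the pair `(p, a)`. -/
def letter {𝔤 : Type*} (gen : A → ℤ → 𝔤) (x : ℕ+ ×ₗ A) : 𝔤 := gen (ofLex x).2 (-weight x)

theorem weight_pos (x : ℕ+ ×ₗ A) : 0 < weight x := (ofLex x).1.pos

theorem weight_toLex (p : ℕ+) (a : A) : weight (toLex (p, a)) = p := rfl

theorem letter_toLex {𝔤 : Type*} (gen : A → ℤ → 𝔤) (p : ℕ+) (a : A) :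
    letter gen (toLex (p, a)) = gen a (-p) := rfl

theorem exists_letter_eq {𝔤 : Type*} (gen : A → ℤ → 𝔤) (a : A) {m : ℤ} (hm : m < 0) :
    ∃ x, letter gen x = gen a m ∧ (weight x : ℤ) = -m := by
  lift -m to ℕ with p hp
  · lia
  · obtain rfl : m = -p := by lia
    exact ⟨toLex (⟨p, by lia⟩, a), rfl, rfl⟩

variable {R : Type*} [CommRing R] {𝔤 : Type*} [LieRing 𝔤] [LieAlgebra R 𝔤]
  {M : Type*} [AddCommGroup M] [Module R M] [LieRingModule 𝔤 M] [LieModule R 𝔤 M]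
  {V : Type*} [AddCommGroup V] [Module R V]

variable {gen : A → ℤ → 𝔤} {Z : Submodule R 𝔤} {t : A → ℤ} {φ : V →ₗ[R] M}

theorem gen_mem_shift_of_neg (a : A) {m : ℤ} (hm : m < 0) :
    gen a m ∈ shift (letter gen) φ weight (-m) := by
  obtain ⟨x, hx, hwx⟩ := exists_letter_eq gen a hm
  exact hx ▸ hwx ▸ letter_mem_shift x

/-- The image of `φ` is stable under `Z` and under the elements `gen a m` of degree `m ≥ 0`, and
those with `m > t a` kill it. -/
structure IsBottom (gen : A → ℤ → 𝔤) (Z : Submodule R 𝔤) (t : A → ℤ) (φ : V →ₗ[R] M) : Prop where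
  lie_mem_range {z : 𝔤} (hz : z ∈ Z) (v : V) : ⁅z, φ v⁆ ∈ LinearMap.range φ
  gen_lie_mem_range (a : A) {m : ℤ} (hm : 0 ≤ m) (v : V) : ⁅gen a m, φ v⁆ ∈ LinearMap.range φ
  gen_lie_eq_zero {a : A} {m : ℤ} (hm : t a < m) (v : V) : ⁅gen a m, φ v⁆ = 0

/-- A family of elements `gen a m` of degree `m ∈ ℤ` and kind `a`, where brackets stay in the
larger of the two kinds, up to terms in the central subspace `Z` that occur in degree `0` only. -/
structure IsTriangular [LinearOrder A] (gen : A → ℤ → 𝔤) (Z : Submodule R 𝔤) : Prop where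
  lie_mem {a b : A} (hab : a ≤ b) {m n : ℤ} (h : m + n ≠ 0) :
    ⁅gen a m, gen b n⁆ ∈ Submodule.span R {gen b (m + n)}
  lie_mem_sup {a b : A} (hab : a ≤ b) (m n : ℤ) :
    ⁅gen a m, gen b n⁆ ∈ Submodule.span R {gen b (m + n)} ⊔ Z
  lie_eq_zero {z : 𝔤} (hz : z ∈ Z) (g : 𝔤) : ⁅z, g⁆ = 0

variable [LinearOrder A]

theorem IsTriangular.lie_mem_span_sup (hgen : IsTriangular gen Z) (a b : A) {m n : ℤ}
    (h : m + n ≠ 0) : ⁅gen a m, gen b n⁆ ∈ Submodule.span R {gen (a ⊔ b) (m + n)} := by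
  obtain hab | hab := le_total a b
  · rw [sup_eq_right.mpr hab]
    exact hgen.lie_mem hab h
  · rw [sup_eq_left.mpr hab, ← lie_skew, add_comm]
    exact neg_mem (hgen.lie_mem hab (by lia))

theorem IsTriangular.lie_mem_span_sup_sup (hgen : IsTriangular gen Z) (a b : A) (m n : ℤ) :
    ⁅gen a m, gen b n⁆ ∈ Submodule.span R {gen (a ⊔ b) (m + n)} ⊔ Z := by
  obtain hab | hab := le_total a b
  · rw [sup_eq_right.mpr hab]
    exact hgen.lie_mem_sup hab m n
  · rw [sup_eq_left.mpr hab, ← lie_skew, add_comm]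
    exact neg_mem (hgen.lie_mem_sup hab n m)

theorem IsTriangular.lie_letter_mem_span (hgen : IsTriangular gen Z) (x y : ℕ+ ×ₗ A) :
    ⁅letter gen x, letter gen y⁆ ∈
      Submodule.span R (letter gen '' {z | weight z = weight x + weight y}) := by
  have hneg : -(weight x : ℤ) + -weight y < 0 := by have := weight_pos x; lia
  obtain ⟨z, hz, hwz⟩ := exists_letter_eq gen ((ofLex x).2 ⊔ (ofLex y).2) hneg
  have hz' : z ∈ {z | weight z = weight x + weight y} := by rw [Set.mem_ofPred_eq]; lia
  refine Submodule.span_mono (Set.singleton_subset_iff.mpr ?_) (hgen.lie_mem_span_sup _ _ hneg.ne)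
  exact ⟨z, hz', hz⟩

/-- The subalgebra spanned by the elements of negative degree of a triangular family. -/
def IsTriangular.negSubalgebra (hgen : IsTriangular gen Z) : LieSubalgebra R 𝔤 where
  __ := Submodule.span R (Set.range (letter gen))
  lie_mem' {u v} hu hv := by
    refine LinearMap.BilinMap.apply_apply_mem_of_mem_span _ _ _
      (LieModule.toEnd R 𝔤 𝔤 : 𝔤 →ₗ[R] Module.End R 𝔤) ?_ u v hu hv
    rintro _ ⟨x, rfl⟩ _ ⟨y, rfl⟩
    exact Submodule.span_mono (Set.image_subset_range _ _) (hgen.lie_letter_mem_span x y)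

theorem IsBottom.centre_le_shift (hφ : IsBottom gen Z t φ) (hgen : IsTriangular gen Z) :
    Z ≤ shift (letter gen) φ weight 0 := fun z hz => by
  refine mem_shift_of_letter (fun v => ?_) fun x => ?_
  · obtain ⟨u, hu⟩ := hφ.lie_mem_range hz v
    exact hu ▸ map_mem_wordFiltration_zero u
  · rw [hgen.lie_eq_zero hz]
    exact zero_mem _

theorem IsBottom.lie_mem_shift (hφ : IsBottom gen Z t φ) (hgen : IsTriangular gen Z) {a b : A}
    {m n k : ℤ} (hmem : gen (a ⊔ b) (m + n) ∈ shift (letter gen) φ weight k)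
    (hk : m + n = 0 → 0 ≤ k) : ⁅gen a m, gen b n⁆ ∈ shift (letter gen) φ weight k := by
  have hle : Submodule.span R {gen (a ⊔ b) (m + n)} ≤ shift (letter gen) φ weight k :=
    (Submodule.span_singleton_le_iff_mem _ _).mpr hmem
  by_cases h : m + n = 0
  · exact sup_le hle ((hφ.centre_le_shift hgen).trans (shift_mono (hk h)))
      (hgen.lie_mem_span_sup_sup a b m n)
  · exact hle (hgen.lie_mem_span_sup a b h)

theorem IsBottom.gen_mem_shift (hφ : IsBottom gen Z t φ) (hgen : IsTriangular gen Z)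
    (ht : Antitone t) (a : A) {m k : ℤ} (hm : -m ≤ k) (hk : min 0 (t a - m) ≤ k) :
    gen a m ∈ shift (letter gen) φ weight k := by
  obtain hneg | hnonneg := lt_or_ge m 0
  · exact shift_mono hm (gen_mem_shift_of_neg a hneg)
  lift m to ℕ using hnonneg
  induction m using Nat.strong_induction_on generalizing a k with
  | _ m ih =>
  refine mem_shift_of_letter (fun v => ?_) fun x => ?_
  · obtain hlt | hle := lt_or_ge (t a) m
    · rw [hφ.gen_lie_eq_zero hlt]
      exact zero_mem _
    · obtain ⟨u, hu⟩ := hφ.gen_lie_mem_range a (Int.natCast_nonneg m) v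
      exact hu ▸ wordFiltration_mono (by lia) (map_mem_wordFiltration_zero u)
  · have hp := weight_pos x
    have hle : t (a ⊔ (ofLex x).2) ≤ t a := ht le_sup_left
    refine hφ.lie_mem_shift hgen ?_ (by lia)
    obtain hneg | hnonneg := lt_or_ge (m - weight x : ℤ) 0
    · exact shift_mono (by lia) (gen_mem_shift_of_neg _ hneg)
    · lift (m - weight x : ℤ) to ℕ using hnonneg with r hr
      rw [← sub_eq_add_neg, ← hr]
      exact ih r (by lia) _ (by lia) (by lia)

theorem IsBottom.exists_mem_shift (hφ : IsBottom gen Z t φ) (hgen : IsTriangular gen Z)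
    (ht : Antitone t) (htop : Submodule.span R (Set.range fun x : A × ℤ => gen x.1 x.2) ⊔ Z = ⊤)
    (g : 𝔤) : ∃ k, g ∈ shift (letter gen) φ weight k := by
  rw [← Submodule.mem_iSup_of_directed _ shift_mono.directed_le]
  have hle : ⊤ ≤ ⨆ k, shift (letter gen) φ weight k := by
    refine htop ▸ sup_le (Submodule.span_le.mpr ?_)
      ((hφ.centre_le_shift hgen).trans (le_iSup _ _))
    rintro _ ⟨⟨a, m⟩, rfl⟩
    exact Submodule.mem_iSup_of_mem (max (-m) 0)
      (hφ.gen_mem_shift hgen ht a (le_max_left _ _) (by lia))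
  exact hle Submodule.mem_top

theorem IsBottom.isDetector (hφ : IsBottom gen Z t φ) (hgen : IsTriangular gen Z)
    (ht : Antitone t) (hpos : ∀ a, 0 < t a) {a b : A} {p : ℕ+} {T : V →ₗ[R] V}
    (hT : Function.Injective T)
    (hlie : ∀ v, ⁅⁅gen b (t b + p), gen a (-p)⁆, φ v⁆ = φ (T v))
    (hlt : ∀ c > a, ⁅gen b (t b + p), gen c (-p)⁆ = 0 ∨ t (b ⊔ c) < t b) :
    IsDetector (letter gen) φ weight (toLex (p, a)) (gen b (t b + p)) T where
  mem_shift := hφ.gen_mem_shift hgen ht b (by have := hpos b; rw [weight_toLex]; lia)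
    (by have := hpos b; rw [weight_toLex]; lia)
  injective := hT
  lie_lie_map := hlie
  lie_lie_letter_mem y := by
    have hp := hpos b
    have hy := weight_pos y
    obtain ⟨c, hc⟩ := Submodule.mem_span_singleton.mp
      (hgen.lie_mem_span_sup b a (m := t b + p) (n := -p) (by lia))
    rw [letter_toLex, ← hc, smul_lie, add_neg_cancel_right]
    refine Submodule.smul_mem _ c (hφ.lie_mem_shift hgen ?_ (by lia))
    exact hφ.gen_mem_shift hgen ht _ (by lia) (by lia)
  lie_letter_mem y hy := by
    have hp := hpos b
    obtain ⟨q, c⟩ := y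
    change ⁅gen b (t b + p), gen c (-q)⁆ ∈ shift _ _ _ (q - p - 1)
    obtain hpq | ⟨rfl, hac⟩ := Prod.Lex.toLex_lt_toLex.mp hy
    · have hpq' : (p : ℕ) < q := hpq
      exact hφ.lie_mem_shift hgen (hφ.gen_mem_shift hgen ht _ (by lia) (by lia)) (by lia)
    · obtain h0 | htc := hlt c hac
      · exact h0 ▸ zero_mem _
      · exact hφ.lie_mem_shift hgen (hφ.gen_mem_shift hgen ht _ (by lia) (by lia)) (by lia)

end Graded

theorem injective_smul_lie {R : Type*} [CommRing R] [IsDomain R] {𝔥 : Type*} [LieRing 𝔥]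
    [LieAlgebra R 𝔥] {V : Type*} [AddCommGroup V] [Module R V] [Module.IsTorsionFree R V]
    [LieRingModule 𝔥 V] [LieModule R 𝔥 V] {s : R} (hs : s ≠ 0) {h : 𝔥}
    (hinj : Function.Injective fun v : V => ⁅h, v⁆) :
    Function.Injective fun v : V => ⁅s • h, v⁆ := by
  simpa only [smul_lie, Function.comp_def] using (smul_right_injective V hs).comp hinj

end LieInduction

namespace ExtHV

open LieInduction

variable (α β F : ℂ) (d : ℕ)

/-- The elements `L_m`, `J_m` and `G_{m-d}` in a uniform notation. With this shift of the index
of `G`, the subalgebra `𝓛_d` is spanned by the elements of index `m ≥ 0` and the centre. -/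
noncomputable def gen : Fin 3 → ℤ → ExtHV α β F
  | 0, m => L α β F m
  | 1, m => J α β F m
  | 2, m => G α β F (m - d)

/-- The span of the central basis vectors. -/
noncomputable def centre : Submodule ℂ (ExtHV α β F) :=
  Submodule.span ℂ {C₁ α β F, C₂ α β F, C₃ α β F}

variable {α β F}

theorem lie_basis (a b : Gen) : ⁅basis α β F a, basis α β F b⁆ = genBracket α β F a b :=
  bracketₗ_basis α β F a b

theorem lie_eq_zero_of_mem_centre {z : ExtHV α β F} (hz : z ∈ centre α β F) (x : ExtHV α β F) :
    ⁅z, x⁆ = 0 := by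
  refine LinearMap.BilinMap.apply_apply_mem_of_mem_span ⊥ _ _
    (LieModule.toEnd ℂ (ExtHV α β F) (ExtHV α β F) : ExtHV α β F →ₗ[ℂ] Module.End ℂ (ExtHV α β F))
    ?_ z x hz ((basis α β F).mem_span x)
  rintro _ hz _ ⟨b, rfl⟩
  obtain rfl | rfl | rfl := hz <;> exact (lie_basis _ b).trans (by cases b <;> rfl)

theorem lie_gen_L_L (m n : ℤ) : ⁅gen α β F d 0 m, gen α β F d 0 n⁆ =
    ((m : ℂ) - n) • gen α β F d 0 (m + n) +
      (if m + n = 0 then ((m : ℂ) ^ 3 - m) / 12 else 0) • C₁ α β F := lie_basis _ _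

theorem lie_gen_L_J (m n : ℤ) : ⁅gen α β F d 0 m, gen α β F d 1 n⁆ =
    (-(n : ℂ)) • gen α β F d 1 (m + n) -
      (if m + n = 0 then (m : ℂ) ^ 2 + m else 0) • C₂ α β F := lie_basis _ _

theorem lie_gen_L_G (m n : ℤ) : ⁅gen α β F d 0 m, gen α β F d 2 n⁆ =
    (-(α + (n - d : ℤ) + m * β)) • gen α β F d 2 (m + n) := by
  rw [gen, gen, gen, add_sub_assoc]
  exact lie_basis _ _

theorem lie_gen_J_J (m n : ℤ) : ⁅gen α β F d 1 m, gen α β F d 1 n⁆ =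
    (if m + n = 0 then (m : ℂ) else 0) • C₃ α β F := lie_basis _ _

theorem lie_gen_J_G (m n : ℤ) : ⁅gen α β F d 1 m, gen α β F d 2 n⁆ =
    F • gen α β F d 2 (m + n) := by
  rw [gen, gen, gen, add_sub_assoc]
  exact lie_basis _ _

theorem lie_gen_G_G (m n : ℤ) : ⁅gen α β F d 2 m, gen α β F d 2 n⁆ = 0 := lie_basis _ _

theorem exists_lie_gen {a b : Fin 3} (hab : a ≤ b) (m n : ℤ) :
    ∃ s : ℂ, ∃ z ∈ centre α β F, ⁅gen α β F d a m, gen α β F d b n⁆ =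
      s • gen α β F d b (m + n) + if m + n = 0 then z else 0 := by
  have hC₁ : C₁ α β F ∈ centre α β F := Submodule.mem_span_of_mem (by simp)
  have hC₂ : C₂ α β F ∈ centre α β F := Submodule.mem_span_of_mem (by simp)
  have hC₃ : C₃ α β F ∈ centre α β F := Submodule.mem_span_of_mem (by simp)
  match a, b, hab with
  | 0, 0, _ => exact ⟨_, (((m : ℂ) ^ 3 - m) / 12) • C₁ α β F, Submodule.smul_mem _ _ hC₁, by
      rw [lie_gen_L_L, ite_smul, zero_smul]⟩
  | 0, 1, _ => exact ⟨_, -(((m : ℂ) ^ 2 + m) • C₂ α β F), neg_mem (Submodule.smul_mem _ _ hC₂), by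
      rw [lie_gen_L_J, sub_eq_add_neg, ite_smul, zero_smul, apply_ite Neg.neg, neg_zero]⟩
  | 0, 2, _ => exact ⟨_, 0, zero_mem _, by rw [lie_gen_L_G, ite_self, add_zero]⟩
  | 1, 1, _ => exact ⟨0, (m : ℂ) • C₃ α β F, Submodule.smul_mem _ _ hC₃, by
      rw [lie_gen_J_J, ite_smul, zero_smul, zero_smul, zero_add]⟩
  | 1, 2, _ => exact ⟨_, 0, zero_mem _, by rw [lie_gen_J_G, ite_self, add_zero]⟩
  | 2, 2, _ => exact ⟨0, 0, zero_mem _, by rw [lie_gen_G_G, ite_self, add_zero, zero_smul]⟩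

theorem isTriangular_gen : IsTriangular (gen α β F d) (centre α β F) where
  lie_mem hab m n h := by
    obtain ⟨s, z, -, hlie⟩ := exists_lie_gen (α := α) (β := β) (F := F) d hab m n
    rw [hlie, if_neg h, add_zero]
    exact Submodule.smul_mem _ s (Submodule.mem_span_singleton_self _)
  lie_mem_sup hab m n := by
    obtain ⟨s, z, hz, hlie⟩ := exists_lie_gen (α := α) (β := β) (F := F) d hab m n
    rw [hlie]
    refine Submodule.add_mem_sup (Submodule.smul_mem _ s (Submodule.mem_span_singleton_self _)) ?_
    split_ifs
    exacts [hz, zero_mem _]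
  lie_eq_zero := lie_eq_zero_of_mem_centre

/-- The degree of a basis vector with respect to the family `gen`; the central basis vectors have
degree `0`. -/
def degree : Gen → ℤ
  | .L m => m
  | .J m => m
  | .G m => m + d
  | _ => 0

theorem range_letter_gen :
    Set.range (letter (gen α β F d)) = basis α β F '' {c | degree d c < 0} := by
  ext x
  constructor
  · rintro ⟨⟨p, a⟩, rfl⟩
    have hp : (-p : ℤ) < 0 := neg_neg_of_pos (mod_cast p.pos)
    match a with
    | 0 => exact ⟨.L (-p), hp, rfl⟩
    | 1 => exact ⟨.J (-p), hp, rfl⟩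
    | 2 => exact ⟨.G (-p - d), (by lia : (-p - d + d : ℤ) < 0), rfl⟩
  · rintro ⟨c, hc, rfl⟩
    obtain ⟨a, h⟩ : ∃ a, gen α β F d a (degree d c) = basis α β F c := by
      match c with
      | .L m => exact ⟨0, rfl⟩
      | .J m => exact ⟨1, rfl⟩
      | .G m => exact ⟨2, congrArg (G α β F) (add_sub_cancel_right m _)⟩
      | .C₁ | .C₂ | .C₃ => exact (lt_irrefl (0 : ℤ) hc).elim
    obtain ⟨y, hy, -⟩ := exists_letter_eq (gen α β F d) a hc
    exact ⟨y, hy.trans h⟩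

theorem posGens_eq_image : posGens α β F d = basis α β F '' {c | 0 ≤ degree d c} := by
  ext x
  constructor
  · rintro (⟨i, rfl⟩ | ⟨i, rfl⟩ | ⟨i, rfl⟩ | rfl | rfl | rfl)
    · exact ⟨.L i, Int.natCast_nonneg i, rfl⟩
    · exact ⟨.J i, Int.natCast_nonneg i, rfl⟩
    · exact ⟨.G (-d + i), (by lia : (0 : ℤ) ≤ -d + i + d), rfl⟩
    · exact ⟨.C₁, le_refl (0 : ℤ), rfl⟩
    · exact ⟨.C₂, le_refl (0 : ℤ), rfl⟩
    · exact ⟨.C₃, le_refl (0 : ℤ), rfl⟩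
  · rintro ⟨c, hc, rfl⟩
    obtain ⟨i, hi⟩ := Int.eq_ofNat_of_zero_le hc.out
    match c with
    | .L m => exact .inl ⟨i, congrArg (L α β F) hi⟩
    | .J m => exact .inr (.inl ⟨i, congrArg (J α β F) hi⟩)
    | .G m =>
      have hm : m + d = i := hi
      exact .inr (.inr (.inl ⟨i, congrArg (G α β F) (by lia)⟩))
    | .C₁ => exact .inr (.inr (.inr (.inl rfl)))
    | .C₂ => exact .inr (.inr (.inr (.inr (.inl rfl))))
    | .C₃ => exact .inr (.inr (.inr (.inr (.inr rfl))))

theorem gen_mem_sub (a : Fin 3) {m : ℤ} (hm : 0 ≤ m) : gen α β F d a m ∈ sub α β F d := by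
  refine Submodule.subset_span ?_
  lift m to ℕ using hm
  match a with
  | 0 => exact .inl ⟨m, rfl⟩
  | 1 => exact .inr (.inl ⟨m, rfl⟩)
  | 2 => exact .inr (.inr (.inl ⟨m, congrArg (G α β F) (by ring)⟩))

theorem centre_le_sub : centre α β F ≤ (sub α β F d).toSubmodule := by
  refine Submodule.span_mono ?_
  rintro x (rfl | rfl | rfl) <;> simp [posGens]

theorem isCompl_negSubalgebra_sub : IsCompl
    (isTriangular_gen (α := α) (β := β) (F := F) d).negSubalgebra.toSubmodule
    (sub α β F d).toSubmodule := by
  change IsCompl (Submodule.span ℂ (Set.range (letter (gen α β F d))))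
    (Submodule.span ℂ (posGens α β F d))
  have hcompl : {c | 0 ≤ degree d c} = {c | degree d c < 0}ᶜ := by
    ext c; exact (not_lt (α := ℤ)).symm
  rw [range_letter_gen, posGens_eq_image, hcompl]
  exact (basis α β F).linearIndependent.isCompl_span_image (basis α β F).span_eq isCompl_compl

theorem span_range_gen_sup_centre :
    Submodule.span ℂ (Set.range fun x : Fin 3 × ℤ => gen α β F d x.1 x.2) ⊔ centre α β F = ⊤ := by
  rw [centre, ← Submodule.span_union, ← top_le_iff, ← (basis α β F).span_eq]
  refine Submodule.span_mono ?_
  rintro _ ⟨c, rfl⟩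
  match c with
  | .L m => exact .inl ⟨(0, m), rfl⟩
  | .J m => exact .inl ⟨(1, m), rfl⟩
  | .G m => exact .inl ⟨(2, m + d), congrArg (G α β F) (add_sub_cancel_right m _)⟩
  | .C₁ => exact .inr (.inl rfl)
  | .C₂ => exact .inr (.inr (.inl rfl))
  | .C₃ => exact .inr (.inr (.inr rfl))

/-- The largest degrees in which the elements `L`, `J` and `G` need not kill the module `V` of the
main theorem: there `gen 2 (k + d)` is `G_k`. -/
def threshold (k l : ℕ) : Fin 3 → ℤ := ![l, k + d, k + d]

variable {k l : ℕ}

theorem threshold_antitone (hl : k + d ≤ l) : Antitone (threshold d k l) :=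
  Fin.antitone_iff_succ_le.mpr fun i => match i with
    | 0 => (mod_cast hl : (k + d : ℤ) ≤ l)
    | 1 => le_refl (k + d : ℤ)

theorem threshold_pos (hkd : 0 < k + d) (hl : k + d ≤ l) (a : Fin 3) : 0 < threshold d k l a :=
  match a with
  | 0 => (mod_cast hkd.trans_le hl : (0 : ℤ) < l)
  | 1 | 2 => (mod_cast hkd : (0 : ℤ) < k + d)

theorem gen_two_natCast_add (i : ℕ) : gen α β F d 2 (i + d) = subG α β F d i :=
  congrArg (G α β F) (add_sub_cancel_right (i : ℤ) d)

section Bottom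

variable {V : Type*} [AddCommGroup V] [Module ℂ V]
  [LieRingModule (sub α β F d) V] [LieModule ℂ (sub α β F d) V]

theorem isBottom_incl
    (hG : ∀ i : ℕ, 1 ≤ i → ∀ v : V, ⁅subG α β F d (k + i), v⁆ = 0)
    (hJ : ∀ i : ℕ, 1 ≤ i → ∀ v : V, ⁅subJ α β F d (k + d + i), v⁆ = 0)
    (hL : ∀ i : ℕ, 1 ≤ i → ∀ v : V, ⁅subL α β F d (l + i), v⁆ = 0) :
    IsBottom (gen α β F d) (centre α β F) (threshold d k l) (incl ℂ (sub α β F d) V) where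
  lie_mem_range hz v := ⟨_, (lie_incl (⟨_, centre_le_sub d hz⟩ : sub α β F d) v).symm⟩
  gen_lie_mem_range a _ hm v :=
    ⟨_, (lie_incl (⟨_, gen_mem_sub d a hm⟩ : sub α β F d) v).symm⟩
  gen_lie_eq_zero {a m} hm v := by
    obtain ⟨i, hi, rfl⟩ : ∃ i : ℕ, 1 ≤ i ∧ m = threshold d k l a + i :=
      ⟨(m - threshold d k l a).toNat, by lia, by lia⟩
    match a with
    | 0 =>
      change ⁅gen α β F d 0 (l + i : ℤ), _⁆ = _
      have h : gen α β F d 0 (l + i : ℤ) = subL α β F d (l + i) := rfl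
      rw [h, lie_incl, hL i hi, map_zero]
    | 1 =>
      have h : gen α β F d 1 (k + d + i : ℤ) = subJ α β F d (k + d + i) := rfl
      exact h ▸ (lie_incl _ v).trans (by rw [hJ i hi, map_zero])
    | 2 =>
      have h : gen α β F d 2 (k + d + i : ℤ) = subG α β F d (k + i) := by
        rw [← gen_two_natCast_add, Nat.cast_add, add_right_comm]
      exact h ▸ (lie_incl _ v).trans (by rw [hG i hi, map_zero])

theorem isDetector_of_lie_eq (hkd : 0 < k + d) (hl : k + d ≤ l)
    (hφ : IsBottom (gen α β F d) (centre α β F) (threshold d k l) (incl ℂ (sub α β F d) V))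
    {p : ℕ+} {a b : Fin 3} {s : ℂ} {h : sub α β F d} (hs : s ≠ 0)
    (hinj : Function.Injective fun v : V => ⁅h, v⁆)
    (hlie : ⁅gen α β F d b (threshold d k l b + p), gen α β F d a (-p)⁆ = s • (h : ExtHV α β F))
    (hlt : ∀ c > a, ⁅gen α β F d b (threshold d k l b + p), gen α β F d c (-p)⁆ = 0 ∨
      threshold d k l (b ⊔ c) < threshold d k l b) :
    IsDetector (letter (gen α β F d)) (incl ℂ (sub α β F d) V) weight (toLex (p, a))
      (gen α β F d b (threshold d k l b + p)) (LieModule.toEnd ℂ (sub α β F d) V (s • h)) :=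
  hφ.isDetector (isTriangular_gen d) (threshold_antitone d hl) (threshold_pos d hkd hl)
    (injective_smul_lie hs hinj) (fun v => by rw [hlie]; exact lie_incl (s • h) v) hlt

theorem exists_isDetector (hF : F ≠ 0) (hkd : 0 < k + d) (hl : k + d < l)
    (hφ : IsBottom (gen α β F d) (centre α β F) (threshold d k l) (incl ℂ (sub α β F d) V))
    (hGinj : Function.Injective fun v : V => ⁅subG α β F d k, v⁆)
    (hLinj : Function.Injective fun v : V => ⁅subL α β F d l, v⁆) (x : ℕ+ ×ₗ Fin 3) :
    ∃ g T, IsDetector (letter (gen α β F d)) (incl ℂ (sub α β F d) V) weight x g T := by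
  obtain ⟨p, a⟩ := x
  have hp := p.pos
  match a with
  | 0 =>
    have hs : (l + 2 * p : ℂ) ≠ 0 := mod_cast (by lia : l + 2 * (p : ℕ) ≠ 0)
    refine ⟨_, _, isDetector_of_lie_eq d (b := 0) hkd hl.le hφ hs hLinj ?_ fun c hc => .inr ?_⟩
    · change ⁅gen α β F d 0 (l + p), gen α β F d 0 (-p)⁆ = (l + 2 * p : ℂ) • gen α β F d 0 l
      rw [lie_gen_L_L, add_neg_cancel_right, if_neg (by lia), zero_smul, add_zero]
      push_cast
      ring_nf
    · match c, hc with
      | 1, _ | 2, _ => exact (mod_cast hl : (k + d : ℤ) < l)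
  | 1 =>
    refine ⟨_, _, isDetector_of_lie_eq d (b := 2) hkd hl.le hφ (neg_ne_zero.mpr hF) hGinj ?_
      fun c hc => .inl ?_⟩
    · change ⁅gen α β F d 2 (k + d + p), gen α β F d 1 (-p)⁆ = _
      rw [← lie_skew, lie_gen_J_G, neg_add_cancel_comm_assoc, neg_smul, gen_two_natCast_add]
    · match c, hc with
      | 2, _ => exact lie_gen_G_G d _ _
  | 2 =>
    refine ⟨_, _, isDetector_of_lie_eq d (b := 1) hkd hl.le hφ hF hGinj ?_
      fun c hc => (hc.not_ge (Fin.le_last c)).elim⟩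
    change ⁅gen α β F d 1 (k + d + p), gen α β F d 2 (-p)⁆ = _
    rw [lie_gen_J_G, add_neg_cancel_right, gen_two_natCast_add]

end Bottom

end ExtHV

theorem mainTheorem3 (α β F : ℂ) (hF : F ≠ 0) (d : ℕ)
    (V : Type*) [AddCommGroup V] [Module ℂ V]
    [LieRingModule (ExtHV.sub α β F d) V] [LieModule ℂ (ExtHV.sub α β F d) V]
    (hV : LieModule.IsIrreducible ℂ (ExtHV.sub α β F d) V)
    (k l : ℕ) (hkd : 0 < k + d) (hl : k + d < l)
    (hGinj : Function.Injective fun v : V => ⁅ExtHV.subG α β F d k, v⁆)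
    (hLinj : Function.Injective fun v : V => ⁅ExtHV.subL α β F d l, v⁆)
    (hG : ∀ i : ℕ, 1 ≤ i → ∀ v : V, ⁅ExtHV.subG α β F d (k + i), v⁆ = 0)
    (hJ : ∀ i : ℕ, 1 ≤ i → ∀ v : V, ⁅ExtHV.subJ α β F d (k + d + i), v⁆ = 0)
    (hL : ∀ i : ℕ, 1 ≤ i → ∀ v : V, ⁅ExtHV.subL α β F d (l + i), v⁆ = 0) :
    LieModule.IsIrreducible ℂ (ExtHV α β F)
      (LieInduction.Ind ℂ (ExtHV.sub α β F d) V) := by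
  have : IsAddTorsionFree V := .of_isTorsionFree ℂ V
  have hgen := ExtHV.isTriangular_gen (α := α) (β := β) (F := F) d
  have hφ := ExtHV.isBottom_incl d hG hJ hL
  refine LieInduction.isIrreducible_ind
    (LieInduction.incl_injective_of_isCompl (ExtHV.isCompl_negSubalgebra_sub d)) fun N hN => ?_
  exact LieInduction.exists_map_mem_of_ne_bot LieInduction.weight_pos hgen.lie_letter_mem_span
    LieInduction.lieSpan_range_incl
    (hφ.exists_mem_shift hgen (ExtHV.threshold_antitone d hl.le)
      (ExtHV.span_range_gen_sup_centre d))
    (ExtHV.exists_isDetector d hF hkd hl hφ hGinj hLinj) hN
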